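/- \textbf{Setting.} A multi-objective graph is a directed graph $G=(V,E)$ whose edges $e$ carry $W\ge 1$ non-negative real values $w_e[1],\dots,w_e[W]$. Let $s\in V$ be a start node from which every node can be reached, and let $\Lambda=\{\lambda_1,\dots,\lambda_K\}$, $K\ge 1$, be a set of $K$ vectors in $\mathbb R^W$ with positive entries. Put $\mathrm{Cost}(p,\lambda)=\sum_{e\in p}\sum_j\lambda[j]\,w_e[j]$ for a path $p$ (loops allowed). The problem is to find, for every $i$ and every $v\in V$, a path from $s$ to $v$ minimising $\mathrm{Cost}(\cdot,\lambda_i)$. A path $p$ dominates a path $q$ with the same end node if it is at most $q$ in every objective and smaller in at least one; a path from $s$ to $v$ is a Pareto path if no path from $s$ to $v$ dominates it. \textbf{Assumptions.} An $l$-node is a node at which at most $l$ Pareto paths end. $L$ is the least integer $l$ for which the proportion of $l$-nodes is at least $1-\frac{\log|V|}{|V|}$. $N_L$ is the maximum, over all $L$-nodes $v$ and Pareto paths $p$ to $v$, of the number of paths from $s$ to $v$ that $p$ does not dominate. Let $F$ be an eventually positive function with $F(n)=o(\log n)$. Fix the constants in the following $O$-bounds. The admissible instances are those for which $L$ exists,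 $N_L$ is finite, and $W=O(1)$; all in- and out-degrees are $O(\log|V|)$; $K=O(\sqrt{|V|})$; $N_L=O(L)$; $N_L\le K/W$; $L=O(F(|V|))$. \textbf{Algorithms.} The \emph{Standard Algorithm} computes, for $i=1,\dots,K$, the edge costs for $\lambda_i$ and runs Dijkstra's algorithm from $s$. \emph{IDAQ} first runs Dijkstra's algorithm for $\lambda_1$, which gives a Pareto path (a sample) to every node. It then maintains a queue of paths, initially the trivial path at $s$, and a list of popped paths; $Q_v$ denotes the paths to $v$ in either of them. In iteration $i$ a queued path $p$ to $v$ is active if its $\lambda_i$-cost is smaller than that of every popped path to $v$ and it is the first pushed among the cheapest queued paths to $v$; a heap holds the active paths. While there is an active path, IDAQ pops one of minimal $\lambda_i$-cost and scans each of its one-edge extensions $q$, to a node $v$ say: $q$ is discarded if the sample to $v$ dominates it. Otherwise, if $|Q_v|<K/W$, then $q$ is pushed iff no path in $Q_v$ dominates it, and the queued paths to $v$ dominated by $q$ are removed. If $|Q_v|\ge K/W$, then $q$ is pushed iff for some $\lambda_j\in\Lambda$ it is cheaper than all paths of $Q_v$; the list $\mathrm{best}_v$, which contains one cheapest path of $Q_v$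 for each $\lambda_j$, is computed when first needed and updated incrementally afterwards, and, when $q$ is pushed, the queued paths to $v$ outside $\mathrm{best}_v$ are removed. When no path is active, IDAQ recomputes the active paths for the next coefficient vector; after the last one, it returns, for each $i$ and $v$, a popped path to $v$ of minimal $\lambda_i$-cost. Running times count elementary operations of a real random access machine; the priority queues are Fibonacci heaps, whose operations on $h$ entries are charged at their amortised cost ($O(1+\log h)$ for deletions, $O(1)$ for all others). Evaluating a cost of a path, or testing dominance between two paths, takes $W$ steps. \textbf{Theorem.} Let $T_{\mathrm{IDAQ}}(n,m)$ and $T_{\mathrm{Std}}(n,m)$ be the worst-case running times of the two algorithms over all admissible instances with $|V|=n$ and $|E|\le m$. Then the time complexity of IDAQ is lower than that of the Standard Algorithm by a factor $\Omega\!\left(\frac{\log|V|}{F(|V|)}\right)$: there is a constant $c>0$ such that for all sufficiently large $n$ and all $m$, $$c\,\frac{\log n}{F(n)}\;T_{\mathrm{IDAQ}}(n,m)\;\le\;T_{\mathrm{Std}}(n,m).$$ The same holds with the number of coefficient vectors prescribed, as long as it is of the order $\sqrt{|V|}$: for every $c_0>0$ there is $c>0$ such that the inequality holds for all sufficiently large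 $n$, all $m$ and all $k\ge c_0\sqrt n$, when both worst cases are taken over the admissible instances with $|V|=n$, $|E|\le m$ and $K=k$. In particular, if $F=O(1)$, then the factor is $\Omega(\log|V|)$: there is $c>0$ with $c\,\log n\;T_{\mathrm{IDAQ}}(n,m)\le T_{\mathrm{Std}}(n,m)$ for all sufficiently large $n$ and all $m$. -/

import Mathlib

open Filter Asymptotics
open scoped ENNReal

namespace MOWSP

noncomputable section

/-! ## Computations with a step count -/

/-- A value together with the number of elementary steps spent on computing it. -/
structure Timed (α : Type) where
  val : α
  time : ℕ

instance : Monad Timed where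
  pure a := ⟨a, 0⟩
  bind x f := ⟨(f x.val).val, x.time + (f x.val).time⟩

/-- Spend `c` elementary steps. -/
def tick (c : ℕ) : Timed Unit := ⟨(), c⟩

/-! ## Multi-objective graphs, paths, optimality -/

/-- A multi-objective graph with node set `Fin n`, given by adjacency lists: `v ∈ out u` means that
`(u, v)` is an edge, and `w u v` is the vector of the `W` objective values of that edge. -/
structure MOG (n W : ℕ) where
  out : Fin n → List (Fin n)
  nodup : ∀ u, (out u).Nodup
  w : Fin n → Fin n → Fin W → ℝ
  w_nonneg : ∀ u, ∀ v ∈ out u, ∀ j, 0 ≤ w u v j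

/-- A path is stored as the list of its nodes, LAST NODE FIRST, so that extending a path by one
edge is a single `cons`. -/
abbrev Path (n : ℕ) := List (Fin n)

namespace MOG

variable {n W : ℕ}

/-- The number of edges `|E|`. -/
def numEdges (G : MOG n W) : ℕ := ∑ u, (G.out u).length

/-- The in-degree of `v`. -/
def inDeg (G : MOG n W) (v : Fin n) : ℕ := (Finset.univ.filter fun u => v ∈ G.out u).card

/-- The out-degree of `v`. -/
def outDeg (G : MOG n W) (v : Fin n) : ℕ := (G.out v).length

/-- `G.IsPath s v p`: `p` is a path from `s` to `v` (loops are allowed). -/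
inductive IsPath (G : MOG n W) (s : Fin n) : Fin n → Path n → Prop
  | start : IsPath G s s [s]
  | step {u v : Fin n} {p : Path n} : IsPath G s u p → v ∈ G.out u → IsPath G s v (v :: p)

/-- The objective vector of a path: the sum of the objective vectors of its edges. -/
def obj (G : MOG n W) : Path n → Fin W → ℝ
  | v :: u :: p => fun j => obj G (u :: p) j + G.w u v j
  | _ => fun _ => 0

/-- The cost of an edge with respect to a coefficient vector. -/
def edgeCost (G : MOG n W) (lam : Fin W → ℝ) (u v : Fin n) : ℝ := ∑ j, lam j * G.w u v j

/-- The cost of a path with respect to a coefficient vector: the sum of the costs of its edges,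
with the two finite sums interchanged. -/
def cost (G : MOG n W) (lam : Fin W → ℝ) (p : Path n) : ℝ := ∑ j, lam j * G.obj p j

end MOG

/-- Pareto dominance of objective vectors: `x` dominates `y`. -/
def Dominates {W : ℕ} (x y : Fin W → ℝ) : Prop := (∀ j, x j ≤ y j) ∧ ∃ j, x j < y j

instance {W : ℕ} (x y : Fin W → ℝ) : Decidable (Dominates x y) := by
  unfold Dominates; infer_instance

/-- An instance of the multi-objective weighted shortest path problem on `n` nodes: a
multi-objective graph with `W ≥ 1` objectives, a start node from which every node can be reached,
and a set of `K ≥ 1` coefficient vectors with positive entries. -/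
structure Problem (n : ℕ) where
  W : ℕ
  W_pos : 0 < W
  K : ℕ
  K_pos : 0 < K
  G : MOG n W
  s : Fin n
  reach : ∀ v, ∃ p, G.IsPath s v p
  coef : Fin K → Fin W → ℝ
  coef_pos : ∀ i j, 0 < coef i j
  coef_inj : Function.Injective coef

namespace Problem

variable {n : ℕ}

/-- `Cost(p, λ_i)`. -/
def cost (I : Problem n) (i : Fin I.K) (p : Path n) : ℝ := I.G.cost (I.coef i) p

/-- `p` is a Pareto path to `v`: no path from the start node to `v` dominates it. -/
def IsPareto (I : Problem n) (v : Fin n) (p : Path n) : Prop :=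
  I.G.IsPath I.s v p ∧ ∀ q, I.G.IsPath I.s v q → ¬ Dominates (I.G.obj q) (I.G.obj p)

/-- `V_L(l)`: the `l`-nodes, at which at most `l` different Pareto paths end. -/
def lNodes (I : Problem n) (l : ℕ) : Set (Fin n) := {v | {p | I.IsPareto v p}.encard ≤ l}

/-- `α(l) = |V_L(l)| / |V|`. -/
def alpha (I : Problem n) (l : ℕ) : ℝ := ((I.lNodes l).ncard : ℝ) / n

/-- `L` is the least `l` with `α(l) ≥ 1 - log |V| / |V|`. -/
def IsL (I : Problem n) (L : ℕ) : Prop := IsLeast {l | 1 - Real.log n / n ≤ I.alpha l} L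

/-- `N_L(l)`: the maximal number of paths to an `l`-node that are not dominated by a single Pareto
path to that node (possibly infinite). -/
def nonDom (I : Problem n) (l : ℕ) : ℕ∞ :=
  ⨆ v ∈ I.lNodes l, ⨆ p ∈ {p | I.IsPareto v p},
    {q | I.G.IsPath I.s v q ∧ ¬ Dominates (I.G.obj p) (I.G.obj q)}.encard

/-- The standing assumptions, with explicit constants in place of the `O`-symbols: `W = O(1)`, the
in- and out-degrees are `O(log |V|)`, `K = O(√|V|)`, `L` exists and is `O(F |V|)`, and `N_L` is
finite, `O(L)` and at most `K / W`. -/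
structure Admissible (F : ℕ → ℝ) (CW Cdeg CK CN CL : ℝ) (I : Problem n) : Prop where
  objectives : (I.W : ℝ) ≤ CW
  out_degree : ∀ v, (I.G.outDeg v : ℝ) ≤ Cdeg * Real.log n
  in_degree : ∀ v, (I.G.inDeg v : ℝ) ≤ Cdeg * Real.log n
  vectors : (I.K : ℝ) ≤ CK * √n
  pareto : ∃ L N : ℕ, I.IsL L ∧ I.nonDom L = N ∧
    (N : ℝ) ≤ CN * L ∧ (N : ℝ) ≤ (I.K : ℝ) / I.W ∧ (L : ℝ) ≤ CL * F n

/-- The admissible instances on `n` nodes with at most `m` edges. -/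
def admissible (F : ℕ → ℝ) (CW Cdeg CK CN CL : ℝ) (n m : ℕ) : Set (Problem n) :=
  {I | I.Admissible F CW Cdeg CK CN CL ∧ I.G.numEdges ≤ m}

/-- The admissible instances on `n` nodes with at most `m` edges and exactly `k` coefficient
vectors. -/
def admissibleWith (F : ℕ → ℝ) (CW Cdeg CK CN CL : ℝ) (n m k : ℕ) : Set (Problem n) :=
  {I | I.Admissible F CW Cdeg CK CN CL ∧ I.G.numEdges ≤ m ∧ I.K = k}

end Problem

/-! ## Cost model

The step counts are those of a real random access machine: an arithmetic operation or a comparison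
of numbers, following or storing a pointer, and a list insertion or deletion at a known position
take one step. A path in memory carries its objective vector, which is computed in `W` steps when
the path is created from its predecessor; so evaluating `Cost(p, λ)` or testing dominance between
two paths takes `W` steps. The lists `Q_v` are kept separately for each node `v`.

Priority queues are Fibonacci heaps, and their operations are charged at the amortised cost of that
data structure: logarithmic in the number of entries for deletions, constant otherwise. -/

/-- A priority queue with at most one entry, consisting of a key and a path, for each node. -/
abbrev Heap (n : ℕ) := Fin n → Option (ℝ × Path n)

namespace Heap

variable {n : ℕ}

def empty : Heap n := fun _ => none

/-- The number of entries. -/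
def size (H : Heap n) : ℕ := (Finset.univ.filter fun v => (H v).isSome).card

/-- Insert an entry for node `v`. -/
def insert (H : Heap n) (v : Fin n) (key : ℝ) (p : Path n) : Timed (Heap n) := do
  tick 1
  return Function.update H v (some (key, p))

/-- Replace the entry of node `v` by one with a smaller key. -/
def decreaseKey (H : Heap n) (v : Fin n) (key : ℝ) (p : Path n) : Timed (Heap n) := do
  tick 1
  return Function.update H v (some (key, p))

/-- Delete the entry of node `v`. -/
def delete (H : Heap n) (v : Fin n) : Timed (Heap n) := do
  tick (1 + Nat.log 2 H.size)
  return Function.update H v none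

/-- The list of all entries, each with its node. -/
def entries (H : Heap n) : List (Fin n × ℝ × Path n) :=
  (List.finRange n).filterMap fun v => (H v).map fun x => (v, x)

/-- Delete and return an entry with minimal key; `none` if the heap is empty. -/
def deleteMin (H : Heap n) : Timed (Option ((Fin n × ℝ × Path n) × Heap n)) := do
  tick (1 + Nat.log 2 H.size)
  return (H.entries.argmin fun e => e.2.1).map fun e => (e, Function.update H e.1 none)

end Heap

/-! ## Dijkstra's algorithm and the Standard Algorithm -/

/-- The state of Dijkstra's algorithm: the heap of the reached but not yet settled nodes, with
tentative distances and paths, and the final paths of the settled nodes. -/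
structure DState (n : ℕ) where
  heap : Heap n
  settled : Fin n → Option (Path n)

section Dijkstra

variable {n W : ℕ}

/-- Relax the edge from `u`, settled with distance `d` and path `p`, to `v`. -/
def relax (c : Fin n → Fin n → ℝ) (u : Fin n) (d : ℝ) (p : Path n) (st : DState n) (v : Fin n) :
    Timed (DState n) := do
  tick 1
  if (st.settled v).isSome then
    return st
  else
    match st.heap v with
    | none =>
      let H ← st.heap.insert v (d + c u v) (v :: p)
      return { st with heap := H }
    | some (k, _) =>
      if d + c u v < k then
        let H ← st.heap.decreaseKey v (d + c u v) (v :: p)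
        return { st with heap := H }
      else
        return st

/-- Settle the node with the smallest tentative distance and relax its outgoing edges. -/
def dijkstraStep (G : MOG n W) (c : Fin n → Fin n → ℝ) (st : DState n) : Timed (DState n) := do
  match ← st.heap.deleteMin with
  | none => return st
  | some ((u, d, p), H) =>
    (G.out u).foldlM (relax c u d p) ⟨H, Function.update st.settled u (some p)⟩

/-- Dijkstra's algorithm from `s` with edge costs `c`: after the initialisation, `n` nodes are
settled one after the other. -/
def dijkstra (G : MOG n W) (c : Fin n → Fin n → ℝ) (s : Fin n) :
    Timed (Fin n → Option (Path n)) := do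
  tick n
  let H ← Heap.empty.insert s 0 [s]
  let st ← (List.range n).foldlM (fun st _ => dijkstraStep G c st) ⟨H, fun _ => none⟩
  return st.settled

/-- Compute the table of the edge costs with respect to `lam`. -/
def weigh (G : MOG n W) (lam : Fin W → ℝ) : Timed (Fin n → Fin n → ℝ) := do
  tick (G.numEdges * W)
  return G.edgeCost lam

/-- The Standard Algorithm: one run of Dijkstra's algorithm for each coefficient vector. -/
def standard (I : Problem n) : Timed (List (Fin n → Option (Path n))) :=
  (List.finRange I.K).foldlM (fun acc i => do
    let c ← weigh I.G (I.coef i)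
    let P ← dijkstra I.G c I.s
    return acc ++ [P]) []

/-- The running time of the Standard Algorithm. -/
def standardTime (I : Problem n) : ℕ := (standard I).time

end Dijkstra

/-! ## The algorithm IDAQ -/

/-- The state of IDAQ. The Adaptive Queue consists of the lists `queue v` of its paths to `v`, in
the order in which they were pushed, together with the Priority Heap `heap` of the paths whose
priority is not null. The list `optimal_paths` is kept as the lists `popped v` of its paths to `v`.
The list `best v` is `none` until it is needed for the first time. -/
structure IState {n : ℕ} (I : Problem n) where
  sample : Fin n → Option (Path n)
  iter : Fin I.K
  queue : Fin n → List (Path n)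
  popped : Fin n → List (Path n)
  best : Fin n → Option (Fin I.K → Path n)
  heap : Heap n

section Idaq

variable {n : ℕ} {I : Problem n}

/-- `Q_v`: the discovered paths to `v`. -/
def IState.disc (st : IState I) (v : Fin n) : List (Path n) := st.popped v ++ st.queue v

/-- Remove from the Adaptive Queue (and from the Priority Heap) the paths to `v` that do not satisfy
`keep`. The list `optimal_paths` keeps every path that was popped. -/
def IState.prune (st : IState I) (v : Fin n) (keep : Path n → Prop) [DecidablePred keep] :
    Timed (IState I) := do
  tick (st.queue v).length
  let q := (st.queue v).filter fun b => keep b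
  match st.heap v with
  | none => return { st with queue := Function.update st.queue v q }
  | some (_, b) =>
    if keep b then
      return { st with queue := Function.update st.queue v q }
    else
      let H ← st.heap.delete v
      return { st with queue := Function.update st.queue v q, heap := H }

/-- Replace each entry of the list `B` for which `p` has strictly smaller cost by `p`. -/
def updateBest (I : Problem n) (p : Path n) (B : Fin I.K → Path n) : Fin I.K → Path n :=
  fun i => if I.cost i (B i) ≤ I.cost i p then B i else p

/-- The Is-Relevant procedure for a path `p` to `v` and the discovered paths `Q`. If `Q_v` has fewer
than `K / W` elements, `p` is tested for non-dominance; otherwise it is compared with the best paths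
for all coefficient vectors. The list `best v` is computed from `Q_v` when it is used for the first
time and from then on kept up to date incrementally. For the last removal, the entries of `best v`
are marked and the queue is then traversed once. -/
def isRelevant (st : IState I) (v : Fin n) (p : Path n) : Timed (Bool × IState I) := do
  tick 1
  let Q := st.disc v
  if Q.length * I.W < I.K then
    tick (Q.length * I.W)
    if ∀ b ∈ Q, ¬ Dominates (I.G.obj b) (I.G.obj p) then
      tick ((st.queue v).length * I.W)
      let st ← st.prune v fun b => ¬ Dominates (I.G.obj p) (I.G.obj b)
      match st.best v with
      | none => return (true, st)
      | some B =>
        tick (2 * I.K * I.W)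
        return (true, { st with best := Function.update st.best v (some (updateBest I p B)) })
    else
      return (false, st)
  else
    let B ← show Timed (Fin I.K → Path n) from
      match st.best v with
      | some B => return B
      | none => do
        tick (Q.length * I.K * I.W)
        return fun i => (Q.argmin (I.cost i)).getD p
    tick (2 * I.K * I.W)
    let B' := updateBest I p B
    let st := { st with best := Function.update st.best v (some B') }
    if ∀ i, I.cost i (B i) ≤ I.cost i p then
      return (false, st)
    else
      tick I.K
      let st ← st.prune v fun b => ∃ i, B' i = b
      return (true, st)

/-- The Push operation. The priority of the new path `p` to `v` is not null iff its cost for the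
current coefficient vector is smaller than that of all the discovered paths to `v`; in that case it
takes the place of the path to `v` in the Priority Heap, if there is one. -/
def push (st : IState I) (v : Fin n) (p : Path n) : Timed (IState I) := do
  tick (1 + (st.disc v).length * I.W)
  let st' := { st with queue := Function.update st.queue v (st.queue v ++ [p]) }
  if ∀ b ∈ st.disc v, I.cost st.iter p < I.cost st.iter b then
    let H ← if (st.heap v).isSome then st.heap.delete v else pure st.heap
    let H ← H.insert v (I.cost st.iter p) p
    return { st' with heap := H }
  else
    return st'

/-- Scan the path that extends the developed path `p` by an edge to `v`. -/
def scan (p : Path n) (st : IState I) (v : Fin n) : Timed (IState I) := do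
  tick (1 + I.W)
  let q := v :: p
  tick I.W
  if ∃ b ∈ st.sample v, Dominates (I.G.obj b) (I.G.obj q) then
    return st
  else
    let (rel, st) ← isRelevant st v q
    if rel then push st v q else return st

/-- Insert into the Priority Heap the path to `v` whose priority for the current coefficient vector
is not null, if there is one: the first path of minimal cost in the queue, provided that its cost is
smaller than that of all the popped paths to `v`. -/
def adaptNode (st : IState I) (v : Fin n) : Timed (IState I) := do
  tick (1 + (st.disc v).length * I.W)
  match (st.queue v).argmin (I.cost st.iter) with
  | none => return st
  | some p =>
    if ∀ b ∈ st.popped v, I.cost st.iter p < I.cost st.iter b then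
      let H ← st.heap.insert v (I.cost st.iter p) p
      return { st with heap := H }
    else
      return st

/-- The Adapt operation. -/
def adapt (st : IState I) (i : Fin I.K) : Timed (IState I) := do
  tick 1
  (List.finRange n).foldlM adaptNode { st with iter := i, heap := Heap.empty }

/-- The Build-Sets procedure: for each coefficient vector and each node `v`, search the list of the
popped paths to `v` for a path of minimal cost. -/
def buildSets (st : IState I) : Timed (Fin I.K → Fin n → Option (Path n)) := do
  tick (I.K * ∑ v, (1 + (st.popped v).length * I.W))
  return fun i v => (st.popped v).argmin (I.cost i)

/-- The initialisation of IDAQ. -/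
def idaqInit (I : Problem n) : Timed (IState I) := do
  let c ← weigh I.G (I.coef ⟨0, I.K_pos⟩)
  let sample ← dijkstra I.G c I.s
  tick n
  let H ← Heap.empty.insert I.s 0 [I.s]
  return { sample := sample
           iter := ⟨0, I.K_pos⟩
           queue := Function.update (fun _ => []) I.s [[I.s]]
           popped := fun _ => []
           best := fun _ => none
           heap := H }

/-- One pass through the main loop of IDAQ: if no path in the queue has a priority other than null,
go to the next iteration, or return the output after the last one; otherwise pop a path with minimal
priority and scan its extensions. -/
def idaqStep (st : IState I) : Timed (IState I ⊕ (Fin I.K → Fin n → Option (Path n))) := do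
  tick 1
  if st.heap.size = 0 then
    if h : st.iter.val + 1 < I.K then
      let st ← adapt st ⟨st.iter.val + 1, h⟩
      return Sum.inl st
    else
      let out ← buildSets st
      return Sum.inr out
  else
    match ← st.heap.deleteMin with
    | none => return Sum.inl st
    | some ((u, _, p), H) =>
      tick 1
      let st := { st with
        heap := H
        queue := Function.update st.queue u ((st.queue u).erase p)
        popped := Function.update st.popped u (st.popped u ++ [p]) }
      let st ← (I.G.out u).foldlM (scan p) st
      return Sum.inl st

/-- The first `t` passes through the main loop of IDAQ. -/
def idaqRun (I : Problem n) : ℕ → Timed (IState I ⊕ (Fin I.K → Fin n → Option (Path n)))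
  | 0 => do
    let st ← idaqInit I
    return Sum.inl st
  | t + 1 => do
    match ← idaqRun I t with
    | Sum.inl st => idaqStep st
    | Sum.inr out => return Sum.inr out

/-- The running time of IDAQ; it is infinite if IDAQ does not terminate. -/
def idaqTime (I : Problem n) : ℕ∞ := ⨆ t, ((idaqRun I t).time : ℕ∞)

end Idaq

/-! ## Worst-case time -/

/-- The worst-case value of the running time `T` over the problem instances in `S`. -/
def worstCase {n : ℕ} (S : Set (Problem n)) (T : Problem n → ℕ∞) : ℝ≥0∞ :=
  ⨆ I ∈ S, ((T I : ℕ∞) : ℝ≥0∞)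

end

end MOWSP

/-! For `K` of order `√n`, the Standard Algorithm can be forced to spend order `n ^ (3/2) * log n`
steps, while IDAQ spends at most order `n ^ (3/2) * F n` on every admissible instance. The two
bounds are independent: the first needs one bad instance, the second treats all of them.

Upper bound. The sample at `v` minimises a cost with positive coefficients, so it is a Pareto path,
and it dominates no path in `Q_v`. Hence `|Q_v| ≤ N_L = O(F n)` at an `L`-node
(`Inv.disc_length_le`), and `best v` is never computed there. For the at most `log n` exceptional
nodes (`numExc_le`) a cruder bound suffices. Within an iteration, costs are popped in nondecreasing
order, and a path in the heap is strictly cheaper than everything popped at its node; so each node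
is popped at most once per iteration (`Inv.pop`), hence at most `K` times. Every discovered path but
the trivial one extends a path popped at a predecessor, which bounds `|Q_v|`
(`Inv.disc_length_le_inDeg`). A potential function pays for every pass through the main loop
(`Inv.idaqStep`). The leading term is the recomputation of the active paths: `K` iterations, `n`
nodes, `N_L * W` steps per `L`-node. Everything else, including the work at exceptional nodes when
scans are counted by their target (`Inv.potential_le`), is `n` times a power of `log n`
(`idaqBound_le`).

Lower bound. In a complete binary tree where node `v` has distance `v` from the root, Dijkstra's
algorithm settles the nodes in numerical order and its heap holds `t + 1` entries after `t` of them,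
as long as all their children exist. So a linear number of deletions costs order `log n` each, for
each of the `K` vectors (`treeProblem_standardTime`). Paths in the tree are unique, whence `L = N_L
= 1`; its number of edges is least possible and `K` is free. It is therefore admissible whenever
some instance is (`treeProblem_admissible`); if none is, the worst case of IDAQ is a supremum over
the empty set, which is zero. -/

namespace MOWSP

/-! ## The step-counting monad -/

namespace Timed

variable {α β : Type}

@[simp] theorem pure_val (a : α) : (pure a : Timed α).val = a := rfl
@[simp] theorem pure_time (a : α) : (pure a : Timed α).time = 0 := rfl
@[simp] theorem bind_val (x : Timed α) (f : α → Timed β) : (x >>= f).val = (f x.val).val := rfl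
@[simp] theorem bind_time (x : Timed α) (f : α → Timed β) :
    (x >>= f).time = x.time + (f x.val).time := rfl
@[simp] theorem tick_time (c : ℕ) : (tick c).time = c := rfl

/-- A Hoare rule for loops: `P` may depend on the remaining list and on the time spent so far. -/
theorem foldlM_rule {f : β → α → Timed β} (P : List α → β → ℕ → Prop)
    (step : ∀ a l b t, P (a :: l) b t → P l (f b a).val (t + (f b a).time)) :
    ∀ (l : List α) (b : β) (t : ℕ), P l b t → P [] (l.foldlM f b).val (t + (l.foldlM f b).time)
  | [], b, t, h => by simpa using h
  | a :: l, b, t, h => by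
    have := foldlM_rule P step l _ _ (step a l b t h)
    simpa [List.foldlM_cons, add_assoc] using this

end Timed

/-! ## Paths and costs -/

namespace MOG

variable {n W : ℕ} {G : MOG n W} {s v : Fin n} {p : Path n}

theorem IsPath.exists_cons (h : G.IsPath s v p) : ∃ l, p = v :: l := by
  cases h with
  | start => exact ⟨[], rfl⟩
  | step h e => exact ⟨_, rfl⟩

theorem IsPath.obj_nonneg (h : G.IsPath s v p) (j : Fin W) : 0 ≤ G.obj p j := by
  induction h with
  | start => simp [obj]
  | step h e ih =>
    obtain ⟨l, rfl⟩ := h.exists_cons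
    simpa [obj] using add_nonneg ih (G.w_nonneg _ _ e j)

theorem cost_start (lam : Fin W → ℝ) : G.cost lam [s] = 0 := by simp [cost, obj]

theorem IsPath.cost_cons (h : G.IsPath s v p) (lam : Fin W → ℝ) (x : Fin n) :
    G.cost lam (x :: p) = G.cost lam p + G.edgeCost lam v x := by
  obtain ⟨l, rfl⟩ := h.exists_cons
  simp [cost, edgeCost, obj, mul_add, Finset.sum_add_distrib]

theorem edgeCost_nonneg {lam : Fin W → ℝ} (hl : ∀ j, 0 < lam j) {u v : Fin n} (h : v ∈ G.out u) :
    0 ≤ G.edgeCost lam u v :=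
  Finset.sum_nonneg fun j _ => mul_nonneg (hl j).le (G.w_nonneg _ _ h j)

theorem IsPath.cost_nonneg (h : G.IsPath s v p) {lam : Fin W → ℝ} (hl : ∀ j, 0 < lam j) :
    0 ≤ G.cost lam p :=
  Finset.sum_nonneg fun j _ => mul_nonneg (hl j).le (h.obj_nonneg j)

theorem cost_lt_of_dominates {lam : Fin W → ℝ} (hl : ∀ j, 0 < lam j) {p q : Path n}
    (h : Dominates (G.obj p) (G.obj q)) : G.cost lam p < G.cost lam q := by
  obtain ⟨h1, j, hj⟩ := h
  exact Finset.sum_lt_sum (fun j _ => mul_le_mul_of_nonneg_left (h1 j) (hl j).le)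
    ⟨j, Finset.mem_univ j, mul_lt_mul_of_pos_left hj (hl j)⟩

end MOG

/-! ## Heaps -/

namespace Heap

variable {n : ℕ}

theorem size_le (H : Heap n) : H.size ≤ n := by
  simpa [size] using Finset.card_le_univ (Finset.univ.filter fun v : Fin n => (H v).isSome)

theorem mem_entries {H : Heap n} {v : Fin n} {x : ℝ × Path n} :
    (v, x) ∈ H.entries ↔ H v = some x := by
  simp [entries]

theorem delete_time_le (H : Heap n) (v : Fin n) : (H.delete v).time ≤ 1 + Nat.log 2 n := by
  simpa [delete] using Nat.log_mono_right (H.size_le)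

theorem deleteMin_time_eq (H : Heap n) : H.deleteMin.time = 1 + Nat.log 2 H.size := by
  simp [deleteMin]

theorem deleteMin_time_le (H : Heap n) : H.deleteMin.time ≤ 1 + Nat.log 2 n := by
  simpa [deleteMin] using Nat.log_mono_right (H.size_le)

theorem deleteMin_eq_some {H H' : Heap n} {v : Fin n} {k : ℝ} {p : Path n}
    (h : H.deleteMin.val = some ((v, k, p), H')) :
    H v = some (k, p) ∧ H' = Function.update H v none ∧
      ∀ w l q, H w = some (l, q) → k ≤ l := by
  simp only [deleteMin, Timed.bind_val, Timed.pure_val, Option.map_eq_some_iff] at h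
  obtain ⟨e, he, h2⟩ := h
  simp only [Prod.mk.injEq] at h2
  obtain ⟨rfl, rfl⟩ := h2
  refine ⟨mem_entries.1 (List.argmin_mem he), rfl, fun w l q hw => ?_⟩
  simpa using List.le_of_mem_argmin (mem_entries.2 hw) he

theorem deleteMin_eq_none {H : Heap n} (h : H.deleteMin.val = none) (v : Fin n) : H v = none := by
  simp only [deleteMin, Timed.bind_val, Timed.pure_val, Option.map_eq_none_iff,
    List.argmin_eq_none] at h
  by_contra hv
  obtain ⟨x, hx⟩ := Option.ne_none_iff_exists'.1 hv
  have := mem_entries.2 hx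
  simp [h] at this

end Heap

/-! ## Dijkstra's algorithm -/

section Dijkstra

variable {n W : ℕ}

theorem relax_time_le (c : Fin n → Fin n → ℝ) (u : Fin n) (d : ℝ) (p : Path n) (st : DState n)
    (v : Fin n) : (relax c u d p st v).time ≤ 2 := by
  unfold relax
  simp only [Timed.bind_time, Timed.tick_time]
  split_ifs
  · simp
  · split
    · simp [Heap.insert]
    · split_ifs <;> simp [Heap.decreaseKey]

theorem dijkstraStep_time_le (G : MOG n W) (c : Fin n → Fin n → ℝ) (st : DState n) {D : ℕ}
    (hD : ∀ u, G.outDeg u ≤ D) : (dijkstraStep G c st).time ≤ 1 + Nat.log 2 n + 2 * D := by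
  unfold dijkstraStep
  simp only [Timed.bind_time]
  refine Nat.add_le_add (Heap.deleteMin_time_le _) ?_
  split
  · simp
  · rename_i u d p H _
    have := Timed.foldlM_rule (f := relax c u d p)
      (fun l _ t => t + 2 * l.length ≤ 2 * (G.out u).length)
      (by
        intro a l b t h
        have := relax_time_le c u d p b a
        simp only [List.length_cons] at h
        omega) (G.out u) ⟨H, Function.update st.settled u (some p)⟩ 0 (by simp)
    have h2 := hD u
    simp only [MOG.outDeg] at h2
    simp only [List.length_nil] at this
    omega

theorem dijkstra_time_le (G : MOG n W) (c : Fin n → Fin n → ℝ) (s : Fin n) {D : ℕ}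
    (hD : ∀ u, G.outDeg u ≤ D) :
    (dijkstra G c s).time ≤ n + 1 + n * (1 + Nat.log 2 n + 2 * D) := by
  unfold dijkstra
  simp only [Timed.bind_time, Timed.tick_time, Timed.pure_time, Heap.insert, Timed.bind_val,
    Timed.pure_val]
  have := Timed.foldlM_rule (f := fun st (_ : ℕ) => dijkstraStep G c st)
      (fun l _ t => t + l.length * (1 + Nat.log 2 n + 2 * D) ≤ n * (1 + Nat.log 2 n + 2 * D))
      (by
        intro a l b t h
        have := dijkstraStep_time_le G c b hD
        simp only [List.length_cons, add_mul, one_mul] at h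
        omega) (List.range n)
      ⟨Function.update Heap.empty s (some (0, [s])), fun _ => none⟩ 0 (by simp)
  simp only [List.length_nil] at this
  omega

/-- The loop invariant of Dijkstra's algorithm. The edges from `u` to the nodes in `pending` have
still to be relaxed. -/
structure DInv (G : MOG n W) (lam : Fin W → ℝ) (s u : Fin n) (pending : List (Fin n))
    (st : DState n) : Prop where
  settled : ∀ v p, st.settled v = some p → G.IsPath s v p ∧
    ∀ q, G.IsPath s v q → G.cost lam p ≤ G.cost lam q
  heap : ∀ v k p, st.heap v = some (k, p) → st.settled v = none ∧ G.IsPath s v p ∧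
    k = G.cost lam p
  relaxed : ∀ x p v, st.settled x = some p → v ∈ G.out x → st.settled v = none →
    (x = u ∧ v ∈ pending) ∨
      ∃ k q, st.heap v = some (k, q) ∧ k ≤ G.cost lam p + G.edgeCost lam x v
  start : st.settled s = none → ∃ k q, st.heap s = some (k, q) ∧ k ≤ 0

variable {G : MOG n W} {lam : Fin W → ℝ} {s : Fin n}

/-- Walking back along `q` from `v`, one reaches an unsettled node that is `s` or has a settled
predecessor. The edge into it has been relaxed, so its key is at most the cost of that prefix of
`q`, and the rest of `q` costs at least zero. Applied to the node with the least key, this makes the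
greedy choice optimal. -/
theorem DInv.exists_heap_le (hl : ∀ j, 0 < lam j) {u : Fin n} {st : DState n}
    (h : DInv G lam s u [] st) {v : Fin n} {q : Path n} (hq : G.IsPath s v q)
    (hv : st.settled v = none) : ∃ w k p, st.heap w = some (k, p) ∧ k ≤ G.cost lam q := by
  induction hq with
  | start =>
    obtain ⟨k, q, hk, hk0⟩ := h.start hv
    exact ⟨_, k, q, hk, by rwa [MOG.cost_start]⟩
  | @step x v q hq e ih =>
    rw [hq.cost_cons]
    have he := MOG.edgeCost_nonneg hl e
    cases hx : st.settled x with
    | none =>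
      obtain ⟨w, k, p, hw, hk⟩ := ih hx
      exact ⟨w, k, p, hw, by linarith⟩
    | some p =>
      rcases h.relaxed x p v hx e hv with h1 | ⟨k, r, hk, hk2⟩
      · simp at h1
      · exact ⟨v, k, r, hk, by linarith [(h.settled x p hx).2 q hq]⟩

theorem relax_settled (c : Fin n → Fin n → ℝ) (u : Fin n) (d : ℝ) (p : Path n) (st : DState n)
    (v : Fin n) : (relax c u d p st v).val.settled = st.settled := by
  unfold relax
  simp only [Timed.bind_val]
  split_ifs
  · rfl
  · split
    · rfl
    · split_ifs <;> rfl

/-- The cases in which the heap stays unchanged are merged into one condition, so that uses need a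
single case split. The decidability instance is a variable because it is supplied classically. -/
theorem relax_heap (c : Fin n → Fin n → ℝ) (u : Fin n) (d : ℝ) (p : Path n) (st : DState n)
    (v : Fin n) [Decidable ((st.settled v).isSome ∨
      ∃ k q, st.heap v = some (k, q) ∧ k ≤ d + c u v)] : (relax c u d p st v).val.heap =
      if (st.settled v).isSome ∨ (∃ k q, st.heap v = some (k, q) ∧ k ≤ d + c u v) then st.heap
      else Function.update st.heap v (some (d + c u v, v :: p)) := by
  unfold relax
  simp only [Timed.bind_val]
  by_cases h1 : (st.settled v).isSome = true
  · simp [h1]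
  · rw [if_neg h1]
    rcases Option.eq_none_or_eq_some (st.heap v) with h2 | ⟨⟨k, q⟩, h2⟩
    · simp [h1, h2, Heap.insert]
    · by_cases h3 : d + c u v < k
      · simp [h1, h2, h3, Heap.decreaseKey]
      · simp [h2, h3, not_lt.1 h3]

open Classical in
theorem DInv.relax {u : Fin n} {p : Path n} {v : Fin n} {l : List (Fin n)} {st : DState n}
    (h : DInv G lam s u (v :: l) st) (hu : st.settled u = some p) (hv : v ∈ G.out u) :
    DInv G lam s u l (relax (G.edgeCost lam) u (G.cost lam p) p st v).val := by
  have hs := relax_settled (G.edgeCost lam) u (G.cost lam p) p st v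
  have hh := relax_heap (G.edgeCost lam) u (G.cost lam p) p st v
  set st' := (MOWSP.relax (G.edgeCost lam) u (G.cost lam p) p st v).val with hst'
  have hp := (h.settled u p hu).1
  -- Relaxing never raises a key, so all earlier upper bounds on keys survive.
  have heap_le : ∀ x k q, st.heap x = some (k, q) → ∃ k' q', st'.heap x = some (k', q') ∧ k' ≤ k := by
    intro x k q hx
    rw [hh]
    split_ifs with hc
    · exact ⟨k, q, hx, le_rfl⟩
    · by_cases hxv : x = v
      · subst hxv
        refine ⟨_, _, Function.update_self .., ?_⟩
        push Not at hc
        exact (hc.2 k q hx).le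
      · exact ⟨k, q, by simp [hxv, hx], le_rfl⟩
  refine ⟨by rw [hs]; exact h.settled, ?_, ?_, ?_⟩
  · intro x k q hx
    rw [hs]
    rw [hh] at hx
    split_ifs at hx with hc
    · exact h.heap x k q hx
    · by_cases hxv : x = v
      · subst hxv
        simp only [Function.update_self, Option.some.injEq, Prod.mk.injEq] at hx
        obtain ⟨rfl, rfl⟩ := hx
        push Not at hc
        refine ⟨by simpa using hc.1, hp.step hv, (hp.cost_cons lam x).symm⟩
      · simp only [Function.update_of_ne hxv] at hx
        exact h.heap x k q hx
  · intro x r y hx hy hy'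
    rw [hs] at hx hy'
    rcases h.relaxed x r y hx hy hy' with ⟨rfl, h2⟩ | ⟨k, q, hk, hk'⟩
    · rcases List.mem_cons.1 h2 with rfl | h2
      · right
        obtain rfl : p = r := by simpa [hu] using hx
        rw [hh]
        split_ifs with hc
        · rcases hc with hc | hc
          · simp [hy'] at hc
          · exact hc
        · exact ⟨_, _, Function.update_self .., le_rfl⟩
      · exact Or.inl ⟨rfl, h2⟩
    · obtain ⟨k', q', h1, h2⟩ := heap_le y k q hk
      exact Or.inr ⟨k', q', h1, h2.trans hk'⟩
  · intro h0
    rw [hs] at h0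
    obtain ⟨k, q, hk, hk0⟩ := h.start h0
    obtain ⟨k', q', h1, h2⟩ := heap_le s k q hk
    exact ⟨k', q', h1, h2.trans hk0⟩

/-- The number of settled nodes. -/
def DState.numSettled (st : DState n) : ℕ :=
  (Finset.univ.filter fun v => (st.settled v).isSome).card

/-- By `DInv.exists_heap_le` and reachability, an empty heap means that every node is settled;
otherwise one more node gets settled. This is the measure by which `n` steps suffice. -/
theorem DInv.dijkstraStep (hl : ∀ j, 0 < lam j) (hr : ∀ v, ∃ p, G.IsPath s v p) {u : Fin n}
    {st : DState n} (h : DInv G lam s u [] st) :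
    (∃ u', DInv G lam s u' [] (dijkstraStep G (G.edgeCost lam) st).val) ∧
      ((∀ v, ((dijkstraStep G (G.edgeCost lam) st).val.settled v).isSome) ∨
        st.numSettled + 1 ≤ (dijkstraStep G (G.edgeCost lam) st).val.numSettled) := by
  unfold MOWSP.dijkstraStep
  simp only [Timed.bind_val]
  split
  · rename_i hn
    refine ⟨⟨u, h⟩, Or.inl fun v => ?_⟩
    simp only [Timed.pure_val]
    by_contra hv
    obtain ⟨q, hq⟩ := hr v
    obtain ⟨w, k, p, hw, -⟩ := h.exists_heap_le hl hq (by simpa using hv)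
    rw [Heap.deleteMin_eq_none hn w] at hw
    cases hw
  · rename_i u d p H hm
    obtain ⟨h1, rfl, h3⟩ := Heap.deleteMin_eq_some hm
    obtain ⟨hu, hup, rfl⟩ := h.heap _ _ _ h1
    have key : DInv G lam s u (G.out u)
        ⟨Function.update st.heap u none, Function.update st.settled u (some p)⟩ := by
      refine ⟨?_, ?_, ?_, ?_⟩
      · intro v q hv
        by_cases hvu : v = u
        · subst hvu
          simp only [Function.update_self, Option.some.injEq] at hv
          subst hv
          refine ⟨hup, fun q hq => ?_⟩
          obtain ⟨w, k, r, hw, hk⟩ := h.exists_heap_le hl hq hu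
          exact (h3 _ _ _ hw).trans hk
        · exact h.settled v q (by simpa [hvu] using hv)
      · intro v k q hv
        by_cases hvu : v = u
        · simp [hvu] at hv
        · simpa [hvu] using h.heap v k q (by simpa [hvu] using hv)
      · intro x r v hx hv hv'
        have hvu : v ≠ u := by rintro rfl; simp at hv'
        by_cases hxu : x = u
        · subst hxu; exact Or.inl ⟨rfl, hv⟩
        · right
          rcases h.relaxed x r v (by simpa [hxu] using hx) hv (by simpa [hvu] using hv') with h4 | h4
          · simp at h4
          · simpa [hvu] using h4
      · intro h0
        have hsu : s ≠ u := by rintro rfl; simp at h0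
        simpa [hsu] using h.start (by simpa [hsu] using h0)
    have := Timed.foldlM_rule (f := MOWSP.relax (G.edgeCost lam) u (G.cost lam p) p)
      (fun l st' _ => (∀ v ∈ l, v ∈ G.out u) ∧ DInv G lam s u l st' ∧
        st'.settled = Function.update st.settled u (some p))
      (by
        rintro a l b t ⟨hmem, hinv, hset⟩
        refine ⟨fun v hv => hmem v (List.mem_cons_of_mem _ hv), ?_, ?_⟩
        · exact hinv.relax (by simp [hset]) (hmem a List.mem_cons_self)
        · rw [relax_settled, hset]) (G.out u) _ 0 ⟨fun _ h => h, key, rfl⟩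
    obtain ⟨-, h4, h5⟩ := this
    refine ⟨⟨u, h4⟩, Or.inr ?_⟩
    unfold DState.numSettled
    rw [h5, ← Finset.card_insert_of_notMem (a := u) (by simp [hu])]
    refine Finset.card_le_card fun v hv => ?_
    by_cases hvu : v = u
    · simp [hvu]
    · simpa [hvu] using hv

theorem dijkstra_correct (hl : ∀ j, 0 < lam j) (hr : ∀ v, ∃ p, G.IsPath s v p) (v : Fin n) :
    ∃ p, (dijkstra G (G.edgeCost lam) s).val v = some p ∧ G.IsPath s v p ∧
      ∀ q, G.IsPath s v q → G.cost lam p ≤ G.cost lam q := by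
  unfold dijkstra
  simp only [Timed.bind_val, Timed.pure_val, Heap.insert]
  have key := Timed.foldlM_rule (f := fun st (_ : ℕ) => dijkstraStep G (G.edgeCost lam) st)
      (fun l st _ => (∃ u, DInv G lam s u [] st) ∧ ((∀ v, (st.settled v).isSome) ∨
        n ≤ st.numSettled + l.length))
      (by
        rintro a l b t ⟨⟨u, h⟩, h2⟩
        obtain ⟨h3, h4⟩ := h.dijkstraStep hl hr
        refine ⟨h3, ?_⟩
        rcases h4 with h4 | h4
        · exact Or.inl h4
        · right
          rcases h2 with h2 | h2
          · have : b.numSettled = n := by simp [DState.numSettled, h2]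
            have h5 : (dijkstraStep G (G.edgeCost lam) b).val.numSettled ≤ n := by
              simpa [DState.numSettled] using Finset.card_le_univ (Finset.univ.filter fun v =>
                ((dijkstraStep G (G.edgeCost lam) b).val.settled v).isSome)
            omega
          · simp only [List.length_cons] at h2
            omega) (List.range n)
      ⟨Function.update Heap.empty s (some (0, [s])), fun _ => none⟩ 0 (by
        refine ⟨⟨s, ?_, ?_, ?_, ?_⟩, Or.inr (by simp)⟩
        · simp
        · intro v k p h
          by_cases hv : v = s
          · subst hv
            simp only [Function.update_self, Option.some.injEq, Prod.mk.injEq] at h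
            obtain ⟨rfl, rfl⟩ := h
            exact ⟨rfl, .start, (MOG.cost_start lam).symm⟩
          · simp [hv, Heap.empty] at h
        · simp
        · intro _
          exact ⟨0, [s], by simp, le_rfl⟩)
  set st := (List.foldlM (fun st (_ : ℕ) => dijkstraStep G (G.edgeCost lam) st)
    (⟨Function.update Heap.empty s (some (0, [s])), fun _ => none⟩ : DState n) (List.range n)).val
  obtain ⟨⟨u, hinv⟩, h2⟩ := key
  have hall : (st.settled v).isSome := by
    rcases h2 with h2 | h2
    · exact h2 v
    · have : (Finset.univ.filter fun v => (st.settled v).isSome) = Finset.univ := by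
        apply Finset.eq_univ_of_card
        apply le_antisymm (Finset.card_le_univ _)
        simpa [DState.numSettled] using h2
      have hv := Finset.mem_univ v
      rw [← this] at hv
      exact (Finset.mem_filter.1 hv).2
  obtain ⟨p, hp⟩ := Option.isSome_iff_exists.1 hall
  exact ⟨p, hp, hinv.settled v p hp⟩

end Dijkstra

/-! ## Invariants of IDAQ -/

section Idaq

variable {n : ℕ} {I : Problem n}

theorem Problem.encard_le_nonDom (I : Problem n) {L : ℕ} {v : Fin n} (hv : v ∈ I.lNodes L)
    {p : Path n} (hp : I.IsPareto v p) :
    {q | I.G.IsPath I.s v q ∧ ¬ Dominates (I.G.obj p) (I.G.obj q)}.encard ≤ I.nonDom L :=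
  le_trans (le_iSup₂ (f := fun p (_ : p ∈ {p | I.IsPareto v p}) =>
    {q | I.G.IsPath I.s v q ∧ ¬ Dominates (I.G.obj p) (I.G.obj q)}.encard) p hp)
    (le_iSup₂ (f := fun v (_ : v ∈ I.lNodes L) => ⨆ p ∈ {p | I.IsPareto v p},
      {q | I.G.IsPath I.s v q ∧ ¬ Dominates (I.G.obj p) (I.G.obj q)}.encard) v hv)

/-- The loop invariant of IDAQ. All paths in the heap have cost at least `d`, where `d` is the cost
of the path that was popped last in the current iteration. -/
structure Inv (I : Problem n) (L : ℕ) (st : IState I) (d : ℝ) : Prop where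
  path : ∀ v, ∀ q ∈ st.disc v, I.G.IsPath I.s v q
  nodup : ∀ v, (st.disc v).Nodup
  tail : ∀ v, ∀ q ∈ st.disc v, q = [I.s] ∨ ∃ u p, q = v :: p ∧ v ∈ I.G.out u ∧ p ∈ st.popped u
  sample : ∀ v, ∃ b, st.sample v = some b ∧ I.IsPareto v b
  nondom : ∀ v, ∀ q ∈ st.disc v, ∀ b ∈ st.sample v, ¬ Dominates (I.G.obj b) (I.G.obj q)
  best : ∀ v ∈ I.lNodes L, st.best v = none
  heap : ∀ v k q, st.heap v = some (k, q) → k = I.cost st.iter q ∧ q ∈ st.queue v ∧ d ≤ k ∧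
    ∀ b ∈ st.popped v, I.cost st.iter q < I.cost st.iter b
  pops : ∀ v, (st.popped v).length ≤ st.iter ∨
    (st.popped v).length ≤ st.iter + 1 ∧ ∃ b ∈ st.popped v, I.cost st.iter b ≤ d

namespace Inv

variable {L : ℕ} {st : IState I} {d : ℝ}

theorem popped_length_le (h : Inv I L st d) (v : Fin n) : (st.popped v).length ≤ I.K := by
  have h2 := st.iter.isLt
  rcases h.pops v with h1 | ⟨h1, -⟩ <;> omega

/-- The sample is one of the Pareto paths over which `nonDom` takes the supremum. The bound is
stated for an arbitrary list so that a path about to be pushed can be counted as well. -/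
theorem card_le_nonDom (h : Inv I L st d) {N : ℕ} (hN : I.nonDom L = N) {v : Fin n}
    (hv : v ∈ I.lNodes L) {l : List (Path n)} (hl : l.Nodup) (hp : ∀ q ∈ l, I.G.IsPath I.s v q)
    (hs : ∀ q ∈ l, ∀ b ∈ st.sample v, ¬ Dominates (I.G.obj b) (I.G.obj q)) : l.length ≤ N := by
  obtain ⟨b, hb, hpar⟩ := h.sample v
  have h1 : {q | I.G.IsPath I.s v q ∧ ¬ Dominates (I.G.obj b) (I.G.obj q)}.encard ≤ N :=
    hN ▸ I.encard_le_nonDom hv hpar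
  have h2 : ((l.toFinset : Finset (Path n)) : Set (Path n)) ⊆
      {q | I.G.IsPath I.s v q ∧ ¬ Dominates (I.G.obj b) (I.G.obj q)} := by
    intro q hq
    have hq' : q ∈ l := by simpa using hq
    exact ⟨hp q hq', hs q hq' b hb⟩
  have h3 := (Set.encard_le_encard h2).trans h1
  rw [Set.encard_coe_eq_coe_finsetCard, List.toFinset_card_of_nodup hl] at h3
  exact_mod_cast h3

theorem disc_length_le (h : Inv I L st d) {N : ℕ} (hN : I.nonDom L = N) {v : Fin n}
    (hv : v ∈ I.lNodes L) : (st.disc v).length ≤ N :=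
  h.card_le_nonDom hN hv (h.nodup v) (h.path v) (h.nondom v)

/-- A new path that survives the test against the sample is one more undominated path. Strictness
keeps `L`-nodes below the threshold `K / W`, even when `N_L = K / W`. -/
theorem disc_length_lt (h : Inv I L st d) {N : ℕ} (hN : I.nonDom L = N) {v : Fin n}
    (hv : v ∈ I.lNodes L) {q : Path n} (hq : I.G.IsPath I.s v q)
    (hs : ∀ b ∈ st.sample v, ¬ Dominates (I.G.obj b) (I.G.obj q)) (hd : q ∉ st.disc v) :
    (st.disc v).length < N := by
  refine h.card_le_nonDom hN hv (l := q :: st.disc v) (List.nodup_cons.2 ⟨hd, h.nodup v⟩) ?_ ?_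
  · exact List.forall_mem_cons.2 ⟨hq, h.path v⟩
  · exact List.forall_mem_cons.2 ⟨hs, h.nondom v⟩

/-- By `tail`, a discovered path other than `[I.s]` is determined by a predecessor of `v` and one of
the at most `K` paths popped there. -/
theorem disc_length_le_inDeg (h : Inv I L st d) (v : Fin n) :
    (st.disc v).length ≤ 1 + I.G.inDeg v * I.K := by
  classical
  rw [← List.toFinset_card_of_nodup (h.nodup v)]
  have h1 : (st.disc v).toFinset ⊆ {[I.s]} ∪ (Finset.univ.filter fun u => v ∈ I.G.out u).biUnion
      fun u => (st.popped u).toFinset.image (v :: ·) := by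
    intro q hq
    rcases h.tail v q (by simpa using hq) with rfl | ⟨u, p, rfl, hu, hp⟩
    · simp
    · simp only [Finset.mem_union, Finset.mem_biUnion, Finset.mem_filter, Finset.mem_univ,
        true_and, Finset.mem_image, List.mem_toFinset]
      exact Or.inr ⟨u, hu, p, hp, rfl⟩
  refine (Finset.card_le_card h1).trans ((Finset.card_union_le _ _).trans ?_)
  refine Nat.add_le_add (by simp) (Finset.card_biUnion_le_card_mul _ _ _ fun u _ => ?_)
  exact Finset.card_image_le.trans ((List.toFinset_card_le _).trans (h.popped_length_le u))

theorem heap_insert (h : Inv I L st d) {v : Fin n} {p : Path n} (hp : p ∈ st.queue v)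
    (hd : d ≤ I.cost st.iter p) (hlt : ∀ b ∈ st.popped v, I.cost st.iter p < I.cost st.iter b) :
    Inv I L { st with heap := Function.update st.heap v (some (I.cost st.iter p, p)) } d := by
  refine ⟨h.path, h.nodup, h.tail, h.sample, h.nondom, h.best, fun w k q hw => ?_, h.pops⟩
  by_cases hwv : w = v
  · subst hwv
    simp only [Function.update_self, Option.some.injEq, Prod.mk.injEq] at hw
    obtain ⟨rfl, rfl⟩ := hw
    exact ⟨rfl, hp, hd, hlt⟩
  · exact h.heap w k q (by simpa [hwv] using hw)

end Inv

/-- `st'` results from `st` by removing queued paths to `v` and changing `best v`. -/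
structure Shrink (st st' : IState I) (v : Fin n) : Prop where
  sample : st'.sample = st.sample
  iter : st'.iter = st.iter
  popped : st'.popped = st.popped
  queue_of_ne : ∀ w, w ≠ v → st'.queue w = st.queue w
  queue : (st'.queue v).Sublist (st.queue v)
  best_of_ne : ∀ w, w ≠ v → st'.best w = st.best w
  heap : ∀ w x, st'.heap w = some x → st.heap w = some x
  heap_mem : ∀ x, st'.heap v = some x → x.2 ∈ st.queue v → x.2 ∈ st'.queue v

namespace Shrink

variable {st st' st'' : IState I} {v : Fin n}

theorem refl (st : IState I) (v : Fin n) : Shrink st st v :=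
  ⟨rfl, rfl, rfl, fun _ _ => rfl, .refl _, fun _ _ => rfl, fun _ _ h => h, fun _ _ h => h⟩

theorem trans (h : Shrink st st' v) (h' : Shrink st' st'' v) : Shrink st st'' v where
  sample := h'.sample.trans h.sample
  iter := h'.iter.trans h.iter
  popped := h'.popped.trans h.popped
  queue_of_ne w hw := (h'.queue_of_ne w hw).trans (h.queue_of_ne w hw)
  queue := h'.queue.trans h.queue
  best_of_ne w hw := (h'.best_of_ne w hw).trans (h.best_of_ne w hw)
  heap w x hx := h.heap w x (h'.heap w x hx)
  heap_mem x hx hq := h'.heap_mem x hx (h.heap_mem x (h'.heap v x hx) hq)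

theorem update_best (st : IState I) (v : Fin n) (B : Option (Fin I.K → Path n)) :
    Shrink st { st with best := Function.update st.best v B } v :=
  ⟨rfl, rfl, rfl, fun _ _ => rfl, .refl _, fun _ hw => Function.update_of_ne hw _ _,
    fun _ _ h => h, fun _ _ h => h⟩

theorem disc_of_ne (h : Shrink st st' v) {w : Fin n} (hw : w ≠ v) : st'.disc w = st.disc w := by
  simp [IState.disc, h.popped, h.queue_of_ne w hw]

theorem disc_sublist (h : Shrink st st' v) (w : Fin n) : (st'.disc w).Sublist (st.disc w) := by
  by_cases hw : w = v
  · subst hw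
    simpa [IState.disc, h.popped] using h.queue
  · rw [h.disc_of_ne hw]

theorem inv (h : Shrink st st' v) {L : ℕ} {d : ℝ} (hi : Inv I L st d)
    (hb : v ∈ I.lNodes L → st'.best v = none) : Inv I L st' d where
  path w q hq := hi.path w q ((h.disc_sublist w).subset hq)
  nodup w := (hi.nodup w).sublist (h.disc_sublist w)
  tail w q hq := by rw [h.popped]; exact hi.tail w q ((h.disc_sublist w).subset hq)
  sample w := by rw [h.sample]; exact hi.sample w
  nondom w q hq := by rw [h.sample]; exact hi.nondom w q ((h.disc_sublist w).subset hq)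
  best w hw := by
    by_cases hwv : w = v
    · subst hwv; exact hb hw
    · rw [h.best_of_ne w hwv]; exact hi.best w hw
  heap w k q hw := by
    rw [h.iter, h.popped]
    obtain ⟨h1, h2, h3⟩ := hi.heap w k q (h.heap w _ hw)
    refine ⟨h1, ?_, h3⟩
    by_cases hwv : w = v
    · subst hwv; exact h.heap_mem _ hw h2
    · rwa [h.queue_of_ne w hwv]
  pops w := by rw [h.popped, h.iter]; exact hi.pops w

end Shrink

/-! ### Removal of queued paths, the relevance test and Push -/

section prune

variable (st : IState I) (v : Fin n) (keep : Path n → Prop) [DecidablePred keep]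

theorem prune_best : (st.prune v keep).val.best = st.best := by
  unfold IState.prune
  simp only [Timed.bind_val]
  split
  · rfl
  · split_ifs <;> rfl

theorem prune_time_le :
    (st.prune v keep).time ≤ (st.queue v).length + 1 + Nat.log 2 n := by
  unfold IState.prune
  simp only [Timed.bind_time, Timed.tick_time]
  rw [add_assoc]
  refine Nat.add_le_add_left ?_ _
  split
  · simp
  · split_ifs
    · simp
    · simpa using Heap.delete_time_le st.heap v

theorem prune_shrink : Shrink st (st.prune v keep).val v := by
  have key : ∀ H : Heap n, (∀ w x, H w = some x → st.heap w = some x) →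
      (∀ x, H v = some x → keep x.2) → Shrink st { st with
        queue := Function.update st.queue v ((st.queue v).filter fun b => keep b), heap := H } v := by
    intro H h1 h2
    refine ⟨rfl, rfl, rfl, fun w hw => Function.update_of_ne hw _ _, ?_, fun _ _ => rfl, h1, ?_⟩
    · simp
    · intro x hx hq
      simpa using ⟨hq, h2 x hx⟩
  unfold IState.prune
  simp only [Timed.bind_val]
  split
  · rename_i hn
    exact key st.heap (fun _ _ h => h) (by simp [hn])
  · rename_i k b hb
    split_ifs with hk
    · exact key st.heap (fun _ _ h => h) (by simpa [hb] using hk)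
    · refine key (Function.update st.heap v none) (fun w x hx => ?_) (by simp)
      by_cases hw : w = v
      · simp [hw] at hx
      · simpa [hw] using hx

end prune

/-- The number of lists `best v` that have been computed. -/
def IState.numBest (st : IState I) : ℕ := (Finset.univ.filter fun v => (st.best v).isSome).card

theorem prune_numBest (st : IState I) (v : Fin n) (keep : Path n → Prop) [DecidablePred keep] :
    (st.prune v keep).val.numBest = st.numBest := by
  simp only [IState.numBest, prune_best]

theorem numBest_update (st st' : IState I) (v : Fin n) (B : Fin I.K → Path n)
    (h : st'.best = Function.update st.best v (some B)) :
    st'.numBest = st.numBest + if (st.best v).isSome then 0 else 1 := by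
  unfold IState.numBest
  rw [h]
  have h1 : (Finset.univ.filter fun w => (Function.update st.best v (some B) w).isSome) =
      insert v (Finset.univ.filter fun w => (st.best w).isSome) := by
    ext w
    by_cases hw : w = v <;> simp [hw]
  rw [h1]
  split_ifs with h2
  · rw [Finset.insert_eq_of_mem (by simpa using h2), add_zero]
  · rw [Finset.card_insert_of_notMem (by simpa using h2)]

/-- The terms with `numBest` on both sides make the time amortised: the one expensive computation of
`best v`, at most `β` steps, is paid by the increase of `numBest`. The conditional term covers the
use of an existing or newly computed list, which never happens at `L`-nodes. -/
theorem isRelevant_spec (st : IState I) (v : Fin n) (q : Path n) {D β : ℕ}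
    (hD : (st.disc v).length ≤ D) (hβ : (st.disc v).length * I.K * I.W ≤ β) :
    Shrink st (isRelevant st v q).val.2 v ∧
    ((st.disc v).length * I.W < I.K → st.best v = none → (isRelevant st v q).val.2.best v = none) ∧
    (isRelevant st v q).time + β * st.numBest ≤ 2 * D * I.W + D + 2 + Nat.log 2 n +
      (if (st.disc v).length * I.W < I.K ∧ st.best v = none then 0 else 2 * I.K * I.W + I.K) +
      β * (isRelevant st v q).val.2.numBest := by
  have hQ : (st.queue v).length ≤ D := le_trans (by simp [IState.disc]) hD
  have hDW := Nat.mul_le_mul_right I.W hD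
  have hQW := Nat.mul_le_mul_right I.W hQ
  have hDW0 := Nat.zero_le (D * I.W)
  unfold isRelevant
  simp only [Timed.bind_val, Timed.bind_time, Timed.tick_time]
  by_cases hb : (st.disc v).length * I.W < I.K
  · rw [if_pos hb]
    simp only [Timed.bind_val, Timed.bind_time, Timed.tick_time, hb, true_and, forall_true_left]
    by_cases h1 : ∀ b ∈ st.disc v, ¬ Dominates (I.G.obj b) (I.G.obj q)
    · rw [if_pos h1]
      simp only [Timed.bind_val, Timed.bind_time, Timed.tick_time]
      have h2 := prune_shrink st v fun b => ¬ Dominates (I.G.obj q) (I.G.obj b)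
      have h3 := prune_time_le st v fun b => ¬ Dominates (I.G.obj q) (I.G.obj b)
      have h4 := prune_best st v fun b => ¬ Dominates (I.G.obj q) (I.G.obj b)
      generalize st.prune v (fun b => ¬ Dominates (I.G.obj q) (I.G.obj b)) = r at h2 h3 h4 ⊢
      have h5 : r.val.numBest = st.numBest := by unfold IState.numBest; rw [h4]
      rcases Option.eq_none_or_eq_some (st.best v) with hB | ⟨B, hB⟩
      · have hB' : r.val.best v = none := by rw [h4, hB]
        simp only [hB', hB, Timed.pure_val, Timed.pure_time, if_true, h5]
        exact ⟨h2, fun _ => trivial, by linarith⟩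
      · have hB' : r.val.best v = some B := by rw [h4, hB]
        simp only [hB', hB, Timed.pure_val, Timed.pure_time, Timed.bind_val, Timed.bind_time,
          Timed.tick_time, reduceCtorEq, false_imp_iff, true_and, if_false]
        refine ⟨h2.trans (.update_best _ _ _), ?_⟩
        rw [numBest_update r.val
          { r.val with best := Function.update r.val.best v (some (updateBest I q B)) } v _ rfl,
          h5, hB']
        simp only [Option.isSome_some, if_true, add_zero]
        linarith
    · rw [if_neg h1]
      refine ⟨.refl _ _, fun h => h, ?_⟩
      simp only [Timed.pure_val, Timed.pure_time]
      have : 0 ≤ if st.best v = none then 0 else 2 * I.K * I.W + I.K := Nat.zero_le _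
      linarith
  · rw [if_neg hb]
    simp only [Timed.bind_val, Timed.bind_time, Timed.tick_time, hb, false_and, if_false,
      false_imp_iff, true_and]
    rcases Option.eq_none_or_eq_some (st.best v) with hB | ⟨B, hB⟩
    · simp only [hB, Timed.bind_val, Timed.bind_time, Timed.pure_val, Timed.pure_time,
        Timed.tick_time]
      generalize (fun i => (List.argmin (I.cost i) (st.disc v)).getD q) = B
      have := numBest_update st
        { st with best := Function.update st.best v (some (updateBest I q B)) } v _ rfl
      simp only [hB, Option.isSome_none, Bool.false_eq_true, if_false] at this
      split_ifs
      · refine ⟨.update_best _ _ _, ?_⟩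
        simp only [Timed.pure_time, Timed.pure_val]
        rw [this]
        linarith
      · simp only [Timed.bind_val, Timed.bind_time, Timed.tick_time, Timed.pure_val,
          Timed.pure_time]
        refine ⟨(Shrink.update_best _ _ _).trans (prune_shrink _ _ _), ?_⟩
        rw [prune_numBest, this]
        refine le_trans (Nat.add_le_add_right (Nat.add_le_add_left (Nat.add_le_add_left
          (Nat.add_le_add_left (Nat.add_le_add_left (Nat.add_le_add_right
            (prune_time_le _ _ _) _) _) _) _) _) _) ?_
        dsimp only
        linarith
    · simp only [hB, Timed.pure_val, Timed.pure_time]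
      have := numBest_update st
        { st with best := Function.update st.best v (some (updateBest I q B)) } v _ rfl
      simp only [hB, Option.isSome_some, if_true, add_zero] at this
      split_ifs
      · refine ⟨.update_best _ _ _, ?_⟩
        simp only [Timed.pure_time, Timed.pure_val]
        rw [this]
        linarith
      · simp only [Timed.bind_val, Timed.bind_time, Timed.tick_time, Timed.pure_val,
          Timed.pure_time]
        refine ⟨(Shrink.update_best _ _ _).trans (prune_shrink _ _ _), ?_⟩
        rw [prune_numBest, this]
        refine le_trans (Nat.add_le_add_right (Nat.add_le_add_left (Nat.add_le_add_left
          (Nat.add_le_add_left (Nat.add_le_add_left (Nat.add_le_add_right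
            (prune_time_le _ _ _) _) _) _) _) _) _) ?_
        dsimp only
        linarith

theorem push_heap (st : IState I) (v : Fin n) (p : Path n)
    [Decidable (∀ b ∈ st.disc v, I.cost st.iter p < I.cost st.iter b)] :
    (push st v p).val = { st with
      queue := Function.update st.queue v (st.queue v ++ [p])
      heap := if ∀ b ∈ st.disc v, I.cost st.iter p < I.cost st.iter b then
        Function.update st.heap v (some (I.cost st.iter p, p)) else st.heap } := by
  unfold push
  simp only [Timed.bind_val]
  by_cases h : ∀ b ∈ st.disc v, I.cost st.iter p < I.cost st.iter b
  · rw [if_pos h, if_pos h]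
    by_cases h2 : (st.heap v).isSome <;> simp [h2, Heap.delete, Heap.insert]
  · rw [if_neg h, if_neg h]
    rfl

theorem push_time_le (st : IState I) (v : Fin n) (p : Path n) :
    (push st v p).time ≤ 3 + (st.disc v).length * I.W + Nat.log 2 n := by
  unfold push
  simp only [Timed.bind_time, Timed.tick_time]
  have := Heap.delete_time_le st.heap v
  split_ifs
  · simp only [Timed.bind_time, Heap.insert, Timed.tick_time, Timed.pure_time]
    omega
  · simp only [Timed.bind_time, Heap.insert, Timed.tick_time, Timed.pure_time]
    omega
  · simp only [Timed.pure_time]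
    omega

theorem Inv.push {L : ℕ} {st : IState I} {d : ℝ} (h : Inv I L st d) {v u : Fin n} {p : Path n}
    (hv : v ∈ I.G.out u) (hp : p ∈ st.popped u) (hpath : I.G.IsPath I.s v (v :: p))
    (hnew : v :: p ∉ st.disc v)
    (hs : ∀ b ∈ st.sample v, ¬ Dominates (I.G.obj b) (I.G.obj (v :: p)))
    (hd : d ≤ I.cost st.iter (v :: p)) : Inv I L (push st v (v :: p)).val d := by
  classical
  rw [push_heap]
  have hmem : ∀ w q, q ∈ st.popped w ++ Function.update st.queue v (st.queue v ++ [v :: p]) w →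
      q ∈ st.disc w ∨ w = v ∧ q = v :: p := by
    intro w q hq
    by_cases hw : w = v
    · subst hw
      simp only [Function.update_self, List.mem_append, List.mem_singleton] at hq
      simp only [IState.disc, List.mem_append]
      tauto
    · left
      simpa [hw, IState.disc] using hq
  have key : Inv I L { st with queue := Function.update st.queue v (st.queue v ++ [v :: p]) } d := by
    refine ⟨?_, ?_, ?_, h.sample, ?_, h.best, ?_, h.pops⟩
    · intro w q hq
      rcases hmem w q hq with hq | ⟨rfl, rfl⟩
      exacts [h.path w q hq, hpath]
    · intro w
      by_cases hw : w = v
      · subst hw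
        simp only [IState.disc, Function.update_self, ← List.append_assoc]
        exact List.nodup_append.2 ⟨h.nodup w, by simp, by
          intro a ha b hb hab
          simp only [List.mem_singleton] at hb
          subst hb hab
          exact hnew ha⟩
      · simpa [IState.disc, hw] using h.nodup w
    · intro w q hq
      rcases hmem w q hq with hq | ⟨rfl, rfl⟩
      exacts [h.tail w q hq, Or.inr ⟨u, p, rfl, hv, hp⟩]
    · intro w q hq
      rcases hmem w q hq with hq | ⟨rfl, rfl⟩
      exacts [h.nondom w q hq, hs]
    · intro w k q hw
      obtain ⟨h1, h2, h3⟩ := h.heap w k q hw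
      refine ⟨h1, ?_, h3⟩
      by_cases hwv : w = v
      · subst hwv; simp [h2]
      · simpa [hwv] using h2
  split_ifs with hc
  · exact key.heap_insert (by simp) hd fun b hb => hc b (by simp [IState.disc, hb])
  · exact key

end Idaq

/-! ### Amortised time of the passes through the main loop -/

section Idaq

variable {n : ℕ} {I : Problem n}

open Classical in
/-- A bound on the number of discovered paths to `v`. -/
noncomputable def discBound (I : Problem n) (L N Δ : ℕ) (v : Fin n) : ℕ :=
  if v ∈ I.lNodes L then N else 1 + Δ * I.K

open Classical in
/-- A bound on the time for scanning a path to `v`, except for the initialisation of `best v`. -/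
noncomputable def scanBound (I : Problem n) (L N Δ : ℕ) (v : Fin n) : ℕ :=
  6 + 2 * I.W + 2 * Nat.log 2 n + 3 * discBound I L N Δ v * I.W + discBound I L N Δ v +
    if v ∈ I.lNodes L then 0 else 2 * I.K * I.W + I.K

/-- A bound on the time for the initialisation of one of the lists `best v`. -/
def bestBound (I : Problem n) (Δ : ℕ) : ℕ := (1 + Δ * I.K) * I.K * I.W

variable {L N Δ : ℕ}

theorem Inv.disc_length_le_discBound {st : IState I} {d : ℝ} (h : Inv I L st d)
    (hN : I.nonDom L = N) (hΔ : ∀ v, I.G.inDeg v ≤ Δ) (v : Fin n) :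
    (st.disc v).length ≤ discBound I L N Δ v := by
  unfold discBound
  split_ifs with hv
  · exact h.disc_length_le hN hv
  · exact (h.disc_length_le_inDeg v).trans (by gcongr; exact hΔ v)

/-- The constants of `scanBound` are those of the three stages: `1 + 2 * W` for creating the path
and testing it against the sample, `isRelevant_spec`, and `push_time_le`. At an `L`-node,
`Inv.disc_length_lt` and `hNK` force the branch of the relevance test that leaves `best v`
uncomputed. -/
theorem Inv.scan {st : IState I} {d : ℝ} (h : Inv I L st d) (hN : I.nonDom L = N)
    (hNK : N * I.W ≤ I.K) (hΔ : ∀ v, I.G.inDeg v ≤ Δ) {u v : Fin n} {p : Path n}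
    (hv : v ∈ I.G.out u) (hp : p ∈ st.popped u) (hnew : v :: p ∉ st.disc v)
    (hd : d ≤ I.cost st.iter p) :
    Inv I L (scan p st v).val d ∧ (scan p st v).val.popped = st.popped ∧
    (scan p st v).val.iter = st.iter ∧ (∀ w, w ≠ v → (scan p st v).val.disc w = st.disc w) ∧
    (scan p st v).time + bestBound I Δ * st.numBest ≤
      scanBound I L N Δ v + bestBound I Δ * (scan p st v).val.numBest := by
  have hup := h.path u p (by simp [IState.disc, hp])
  have hpath := hup.step hv
  have hDle := h.disc_length_le_discBound hN hΔ v
  have hβ : (st.disc v).length * I.K * I.W ≤ bestBound I Δ := by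
    unfold bestBound
    gcongr
    exact (h.disc_length_le_inDeg v).trans (by gcongr; exact hΔ v)
  have hDW := Nat.mul_le_mul_right I.W hDle
  have hdq : d ≤ I.cost st.iter (v :: p) := by
    have := hup.cost_cons (I.coef st.iter) v
    have h2 := MOG.edgeCost_nonneg (G := I.G) (I.coef_pos st.iter) hv
    simp only [Problem.cost] at hd ⊢
    linarith
  unfold MOWSP.scan
  simp only [Timed.bind_val, Timed.bind_time, Timed.tick_time]
  by_cases hs : ∃ b ∈ st.sample v, Dominates (I.G.obj b) (I.G.obj (v :: p))
  · rw [if_pos hs]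
    simp only [Timed.pure_val, Timed.pure_time]
    refine ⟨h, trivial, trivial, fun _ _ => trivial, ?_⟩
    unfold scanBound
    omega
  · rw [if_neg hs]
    push Not at hs
    obtain ⟨hsh, hbest, htime⟩ := isRelevant_spec st v (v :: p) hDle hβ
    simp only [Timed.bind_val, Timed.bind_time]
    generalize isRelevant st v (v :: p) = r at hsh hbest htime ⊢
    obtain ⟨⟨rel, st1⟩, t⟩ := r
    dsimp only at hsh hbest htime ⊢
    have hL : v ∈ I.lNodes L → (st.disc v).length * I.W < I.K := fun hvL =>
      lt_of_lt_of_le (Nat.mul_lt_mul_of_pos_right (h.disc_length_lt hN hvL hpath hs hnew) I.W_pos)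
        hNK
    have hb1 : v ∈ I.lNodes L → st1.best v = none := fun hvL => hbest (hL hvL) (h.best v hvL)
    have h1 : Inv I L st1 d := hsh.inv h hb1
    have hextra : (if (st.disc v).length * I.W < I.K ∧ st.best v = none then 0
        else 2 * I.K * I.W + I.K) ≤ scanBound I L N Δ v - (6 + 2 * I.W + 2 * Nat.log 2 n +
          3 * discBound I L N Δ v * I.W + discBound I L N Δ v) := by
      unfold scanBound
      rw [Nat.add_sub_cancel_left]
      by_cases hvL : v ∈ I.lNodes L
      · rw [if_pos ⟨hL hvL, h.best v hvL⟩]; exact Nat.zero_le _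
      · rw [if_neg hvL]
        split_ifs
        · exact Nat.zero_le _
        · exact le_rfl
    have hS : 6 + 2 * I.W + 2 * Nat.log 2 n + 3 * discBound I L N Δ v * I.W + discBound I L N Δ v
        ≤ scanBound I L N Δ v := by
      unfold scanBound; omega
    have e1 : 2 * discBound I L N Δ v * I.W = 2 * (discBound I L N Δ v * I.W) := by ring
    have e2 : 3 * discBound I L N Δ v * I.W = 3 * (discBound I L N Δ v * I.W) := by ring
    have hdl : (st1.disc v).length ≤ (st.disc v).length := (hsh.disc_sublist v).length_le
    have hdlW := Nat.mul_le_mul_right I.W hdl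
    cases rel with
    | false =>
      simp only [Bool.false_eq_true, if_false, Timed.pure_val, Timed.pure_time]
      refine ⟨h1, hsh.popped, hsh.iter, fun w hw => hsh.disc_of_ne hw, ?_⟩
      omega
    | true =>
      simp only [if_true]
      have hpt := push_time_le st1 v (v :: p)
      have hpi : Inv I L (MOWSP.push st1 v (v :: p)).val d := h1.push hv (by rwa [hsh.popped]) hpath
        (fun hm => hnew ((hsh.disc_sublist v).subset hm)) (by rwa [hsh.sample])
        (by rwa [hsh.iter])
      refine ⟨hpi, ?_, ?_, fun w hw => ?_, ?_⟩
      · rw [push_heap]; exact hsh.popped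
      · rw [push_heap]; exact hsh.iter
      · rw [← hsh.disc_of_ne hw, push_heap]
        simp [IState.disc, hw]
      · have : (MOWSP.push st1 v (v :: p)).val.numBest = st1.numBest := by
          rw [push_heap]; rfl
        rw [this]
        omega

/-- Scanning all the extensions of a path `p` to `u` that has just been popped. -/
theorem Inv.foldlM_scan {st : IState I} {d : ℝ} (h : Inv I L st d) (hN : I.nonDom L = N)
    (hNK : N * I.W ≤ I.K) (hΔ : ∀ v, I.G.inDeg v ≤ Δ) {u : Fin n} {p : Path n}
    (hp : p ∈ st.popped u) (hnew : ∀ v ∈ I.G.out u, v :: p ∉ st.disc v)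
    (hd : d ≤ I.cost st.iter p) :
    Inv I L ((I.G.out u).foldlM (MOWSP.scan p) st).val d ∧
    ((I.G.out u).foldlM (MOWSP.scan p) st).val.popped = st.popped ∧
    ((I.G.out u).foldlM (MOWSP.scan p) st).val.iter = st.iter ∧
    ((I.G.out u).foldlM (MOWSP.scan p) st).time + bestBound I Δ * st.numBest ≤
      ((I.G.out u).map (scanBound I L N Δ)).sum +
        bestBound I Δ * ((I.G.out u).foldlM (MOWSP.scan p) st).val.numBest := by
  have key := Timed.foldlM_rule (f := MOWSP.scan p)
    (fun l st' t => l.Nodup ∧ (∀ v ∈ l, v ∈ I.G.out u ∧ v :: p ∉ st'.disc v) ∧ Inv I L st' d ∧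
      st'.popped = st.popped ∧ st'.iter = st.iter ∧
      t + (l.map (scanBound I L N Δ)).sum + bestBound I Δ * st.numBest ≤
      ((I.G.out u).map (scanBound I L N Δ)).sum + bestBound I Δ * st'.numBest)
    (by
      rintro a l st' t ⟨hnd, hl, hi, hpop, hit, ht⟩
      obtain ⟨ha, hnd⟩ := List.nodup_cons.1 hnd
      obtain ⟨hl1, hl2⟩ := List.forall_mem_cons.1 hl
      obtain ⟨h1, h2, h3, h4, h5⟩ := hi.scan hN hNK hΔ hl1.1 (by rwa [hpop]) hl1.2 (by rwa [hit])
      refine ⟨hnd, fun v hv => ⟨(hl2 v hv).1, ?_⟩, h1, h2.trans hpop, h3.trans hit, ?_⟩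
      -- Scanning the extension to `a` alters only the discovered paths to `a`, and adjacency lists
      -- have no repetitions; so the remaining extensions are still new.
      · rw [h4 v (by rintro rfl; exact ha hv)]
        exact (hl2 v hv).2
      · simp only [List.map_cons, List.sum_cons] at ht
        omega) (I.G.out u) st 0
    ⟨I.G.nodup u, fun v hv => ⟨hv, hnew v hv⟩, h, rfl, rfl, by omega⟩
  obtain ⟨-, -, h1, h2, h3, h4⟩ := key
  refine ⟨h1, h2, h3, ?_⟩
  simpa using h4

theorem adaptNode_spec {st : IState I} (h : Inv I L st 0) (v : Fin n) :
    Inv I L (adaptNode st v).val 0 ∧ (adaptNode st v).val.popped = st.popped ∧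
    (adaptNode st v).val.iter = st.iter ∧ (adaptNode st v).val.best = st.best ∧
    (adaptNode st v).time ≤ 2 + (st.disc v).length * I.W := by
  unfold adaptNode
  simp only [Timed.bind_val, Timed.bind_time, Timed.tick_time]
  split
  · exact ⟨h, rfl, rfl, rfl, by simp only [Timed.pure_time]; omega⟩
  · rename_i p hp
    split_ifs with hc
    · have hpq : p ∈ st.queue v := List.argmin_mem hp
      refine ⟨h.heap_insert hpq ?_ hc, rfl, rfl, rfl, ?_⟩
      · exact (h.path v p (by simp [IState.disc, hpq])).cost_nonneg (I.coef_pos _)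
      · simp only [Timed.bind_time, Heap.insert, Timed.tick_time, Timed.pure_time]
        omega
    · exact ⟨h, rfl, rfl, rfl, by simp only [Timed.pure_time]; omega⟩

/-- In a new iteration `d` restarts at `0`, since costs are nonnegative. As the iteration number
grows by one, both alternatives of `pops` become the first one. -/
theorem adapt_spec {st : IState I} {d : ℝ} (h : Inv I L st d) (hN : I.nonDom L = N)
    (hΔ : ∀ v, I.G.inDeg v ≤ Δ) (i : Fin I.K) (hi : i.val = st.iter + 1) :
    Inv I L (adapt st i).val 0 ∧ (adapt st i).val.popped = st.popped ∧
    (adapt st i).val.iter = i ∧ (adapt st i).val.best = st.best ∧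
    (adapt st i).time ≤ 1 + ∑ v, (2 + discBound I L N Δ v * I.W) := by
  have h0 : Inv I L { st with iter := i, heap := Heap.empty } 0 := by
    refine ⟨h.path, h.nodup, h.tail, h.sample, h.nondom, h.best, ?_, fun v => Or.inl ?_⟩
    · intro v k q hv
      simp [Heap.empty] at hv
    · rcases h.pops v with h1 | ⟨h1, -⟩
      · dsimp only; omega
      · dsimp only; omega
  have key := Timed.foldlM_rule (f := adaptNode (I := I))
    (fun l st' t => Inv I L st' 0 ∧ st'.popped = st.popped ∧ st'.iter = i ∧ st'.best = st.best ∧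
      t + (l.map fun v => 2 + discBound I L N Δ v * I.W).sum ≤
        ∑ v, (2 + discBound I L N Δ v * I.W))
    (by
      rintro a l st' t ⟨hi, hpop, hit, hbest, ht⟩
      obtain ⟨h1, h2, h3, h4, h5⟩ := adaptNode_spec hi a
      refine ⟨h1, h2.trans hpop, h3.trans hit, h4.trans hbest, ?_⟩
      have := Nat.mul_le_mul_right I.W (hi.disc_length_le_discBound hN hΔ a)
      simp only [List.map_cons, List.sum_cons] at ht
      omega) (List.finRange n) _ 0 ⟨h0, rfl, rfl, rfl, by
        rw [zero_add, ← List.ofFn_eq_map, List.sum_ofFn]⟩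
  unfold adapt
  simp only [Timed.bind_val, Timed.bind_time, Timed.tick_time]
  obtain ⟨h1, h2, h3, h4, h5⟩ := key
  refine ⟨h1, h2, h3, h4, ?_⟩
  simpa using h5

/-- All coefficients are positive, so a dominating path would be strictly cheaper. -/
theorem isPareto_of_minimal {i : Fin I.K} {v : Fin n} {p : Path n} (hp : I.G.IsPath I.s v p)
    (hmin : ∀ q, I.G.IsPath I.s v q → I.cost i p ≤ I.cost i q) : I.IsPareto v p :=
  ⟨hp, fun q hq hd => (hmin q hq).not_gt (MOG.cost_lt_of_dominates (I.coef_pos i) hd)⟩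

theorem idaqInit_inv (I : Problem n) (L : ℕ) : Inv I L (idaqInit I).val 0 := by
  have hdisc : ∀ v q, q ∈ (idaqInit I).val.disc v → v = I.s ∧ q = [I.s] := by
    intro v q hq
    by_cases hv : v = I.s
    · subst hv
      exact ⟨rfl, by simpa [idaqInit, IState.disc, Heap.insert] using hq⟩
    · simp [idaqInit, IState.disc, Heap.insert, hv] at hq
  refine ⟨?_, ?_, ?_, ?_, ?_, fun _ _ => rfl, ?_, ?_⟩
  · intro v q hq
    obtain ⟨rfl, rfl⟩ := hdisc v q hq
    exact .start
  · intro v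
    by_cases hv : v = I.s
    · subst hv; simp [idaqInit, IState.disc, Heap.insert]
    · simp [idaqInit, IState.disc, Heap.insert, hv]
  · intro v q hq
    exact Or.inl (hdisc v q hq).2
  · intro v
    obtain ⟨b, hb, hpath, hmin⟩ := dijkstra_correct (I.coef_pos ⟨0, I.K_pos⟩) I.reach v
    exact ⟨b, hb, isPareto_of_minimal hpath hmin⟩
  · intro v q hq b hb hdom
    obtain ⟨rfl, rfl⟩ := hdisc v q hq
    obtain ⟨b', hb', hpath, -⟩ := dijkstra_correct (I.coef_pos ⟨0, I.K_pos⟩) I.reach I.s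
    obtain rfl : b' = b := by
      have : some b' = some b := hb'.symm.trans hb
      simpa using this
    obtain ⟨j, hj⟩ := hdom.2
    have := hpath.obj_nonneg j
    simp only [MOG.obj] at hj
    linarith
  · intro v k q hv
    by_cases hvs : v = I.s
    · subst hvs
      have hv' : 0 = k ∧ [I.s] = q := by simpa [idaqInit, Heap.insert] using hv
      obtain ⟨rfl, rfl⟩ := hv'
      refine ⟨(MOG.cost_start _).symm, by simp [idaqInit, Heap.insert], le_rfl, ?_⟩
      simp [idaqInit, Heap.insert]
    · simp [idaqInit, Heap.insert, hvs, Heap.empty] at hv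
  · intro v
    left
    simp [idaqInit, Heap.insert]

theorem idaqInit_time_le (I : Problem n) {Δ : ℕ} (hΔ : ∀ v, I.G.outDeg v ≤ Δ) :
    (idaqInit I).time ≤ n * Δ * I.W + (n + 1 + n * (1 + Nat.log 2 n + 2 * Δ)) + n + 1 := by
  unfold idaqInit weigh
  simp only [Timed.bind_time, Timed.bind_val, Timed.tick_time, Timed.pure_time, Timed.pure_val,
    Heap.insert]
  have h1 := dijkstra_time_le I.G (I.G.edgeCost (I.coef ⟨0, I.K_pos⟩)) I.s hΔ
  have h2 : I.G.numEdges ≤ n * Δ := by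
    unfold MOG.numEdges
    simpa using Finset.sum_le_card_nsmul Finset.univ (fun u => (I.G.out u).length) Δ
      fun u _ => hΔ u
  have h3 := Nat.mul_le_mul_right I.W h2
  omega

/-- Bound on the time of a pass through the main loop in which a path to `u` is popped. -/
noncomputable def popBound (I : Problem n) (L N Δ : ℕ) (u : Fin n) : ℕ :=
  3 + Nat.log 2 n + ((I.G.out u).map (scanBound I L N Δ)).sum

/-- Bound on the time of a pass through the main loop in which the active paths are recomputed. -/
noncomputable def adaptBound (I : Problem n) (L N Δ : ℕ) : ℕ :=
  2 + ∑ v, (2 + discBound I L N Δ v * I.W)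

/-- The amortised time spent after the initialisation. -/
noncomputable def IState.potential (st : IState I) (L N Δ : ℕ) : ℕ :=
  st.iter * adaptBound I L N Δ + ∑ u, (st.popped u).length * popBound I L N Δ u +
    bestBound I Δ * st.numBest

/-- The popped key `k` is minimal, so it becomes the new lower bound. A second pop at `u` in the
same iteration is impossible: some popped path to `u` would have cost at most `d`, whereas the heap
entry costs at least `d` and strictly less than every popped path to `u`. -/
theorem Inv.pop {st : IState I} {d k : ℝ} (h : Inv I L st d) {u : Fin n} {p : Path n}
    (hu : st.heap u = some (k, p)) (hmin : ∀ w l q, st.heap w = some (l, q) → k ≤ l) :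
    Inv I L { st with
      heap := Function.update st.heap u none
      queue := Function.update st.queue u ((st.queue u).erase p)
      popped := Function.update st.popped u (st.popped u ++ [p]) } k := by
  obtain ⟨rfl, hpq, hdk, hlt⟩ := h.heap u k p hu
  set st' : IState I := { st with
      heap := Function.update st.heap u none
      queue := Function.update st.queue u ((st.queue u).erase p)
      popped := Function.update st.popped u (st.popped u ++ [p]) } with hst'
  have hperm : ∀ v, (st'.disc v).Perm (st.disc v) := by
    intro v
    by_cases hv : v = u
    · subst hv
      simp only [hst', IState.disc, Function.update_self, List.append_assoc]
      exact (List.perm_cons_erase hpq).symm.append_left _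
    · simp [hst', IState.disc, hv]
  have hsub : ∀ v, ∀ q ∈ st.popped v, q ∈ st'.popped v := by
    intro v q hq
    by_cases hv : v = u
    · subst hv; simp [hst', hq]
    · simpa [hst', hv] using hq
  refine ⟨fun v q hq => h.path v q ((hperm v).subset hq), fun v => (hperm v).nodup_iff.2 (h.nodup v),
    fun v q hq => ?_, h.sample, fun v q hq => h.nondom v q ((hperm v).subset hq), h.best, ?_, ?_⟩
  · rcases h.tail v q ((hperm v).subset hq) with h1 | ⟨x, r, h1, h2, h3⟩
    exacts [Or.inl h1, Or.inr ⟨x, r, h1, h2, hsub x r h3⟩]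
  · intro v l q hv
    by_cases hvu : v = u
    · subst hvu; simp [hst'] at hv
    · simp only [hst', Function.update_of_ne hvu] at hv ⊢
      obtain ⟨h1, h2, h3, h4⟩ := h.heap v l q hv
      exact ⟨h1, h2, hmin v l q hv, h4⟩
  · intro v
    by_cases hvu : v = u
    · subst hvu
      right
      rcases h.pops v with h1 | ⟨h1, b, hb, hbd⟩
      · exact ⟨by simpa [hst'] using h1, p, by simp [hst'], le_rfl⟩
      · exact absurd (hlt b hb) (by linarith)
    · simp only [hst', Function.update_of_ne hvu]
      rcases h.pops v with h1 | ⟨h1, b, hb, hbd⟩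
      · exact Or.inl h1
      · exact Or.inr ⟨h1, b, hb, hbd.trans hdk⟩

/-- A pass that adapts raises the iteration number, a pass that pops raises the number of popped
paths at one node, and each first computation of a list `best v` raises `numBest`; the weights in
the potential are bounds on the corresponding times. Only the final output is not covered by the
potential. -/
theorem Inv.idaqStep {st : IState I} {d : ℝ} (h : Inv I L st d) (hN : I.nonDom L = N)
    (hNK : N * I.W ≤ I.K) (hΔ : ∀ v, I.G.inDeg v ≤ Δ) :
    (∀ st', (idaqStep st).val = Sum.inl st' → (∃ d', Inv I L st' d') ∧
      (MOWSP.idaqStep st).time + st.potential L N Δ ≤ st'.potential L N Δ) ∧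
    (∀ out, (MOWSP.idaqStep st).val = Sum.inr out →
      (MOWSP.idaqStep st).time ≤ I.K * adaptBound I L N Δ + 1) := by
  unfold MOWSP.idaqStep
  simp only [Timed.bind_val, Timed.bind_time, Timed.tick_time]
  split_ifs with h0 h1
  · obtain ⟨h2, h3, h4, h5, h6⟩ := adapt_spec h hN hΔ ⟨st.iter.val + 1, h1⟩ rfl
    simp only [Timed.bind_val, Timed.bind_time, Timed.pure_val, Timed.pure_time]
    refine ⟨?_, fun _ h => by simp at h⟩
    intro st' he
    obtain rfl := Sum.inl.inj he
    refine ⟨⟨0, h2⟩, ?_⟩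
    unfold IState.potential IState.numBest
    rw [h3, h4, h5]
    dsimp only
    rw [add_mul, one_mul]
    unfold adaptBound
    omega
  · simp only [Timed.bind_val, Timed.bind_time, Timed.pure_val, Timed.pure_time, buildSets,
      Timed.tick_time]
    refine ⟨fun _ h => by simp at h, fun _ _ => ?_⟩
    have : ∑ v, (1 + (st.popped v).length * I.W) ≤ adaptBound I L N Δ := by
      unfold adaptBound
      refine le_trans (Finset.sum_le_sum fun v _ => ?_) (Nat.le_add_left _ _)
      have h2 : (st.popped v).length ≤ (st.disc v).length := by simp [IState.disc]
      have h3 := Nat.mul_le_mul_right I.W (h2.trans (h.disc_length_le_discBound hN hΔ v))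
      omega
    have := Nat.mul_le_mul_left I.K this
    omega
  · simp only [Timed.bind_val, Timed.bind_time]
    have htime := st.heap.deleteMin_time_le
    split
    · rename_i hn
      refine absurd ?_ h0
      have := Heap.deleteMin_eq_none hn
      simp [Heap.size, this]
    · rename_i u k p H hm
      obtain ⟨hu, rfl, hmin⟩ := Heap.deleteMin_eq_some hm
      simp only [Timed.bind_val, Timed.bind_time, Timed.pure_val, Timed.pure_time,
        Timed.tick_time]
      refine ⟨?_, fun _ h => by simp at h⟩
      intro st' he
      have hpop := h.pop hu hmin
      obtain ⟨hk, hpq, -, -⟩ := h.heap u k p hu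
      have hnp : p ∉ st.popped u := fun hp =>
        (List.nodup_append.1 (h.nodup u)).2.2 p hp p hpq rfl
      set st1 : IState I := { st with
        heap := Function.update st.heap u none
        queue := Function.update st.queue u ((st.queue u).erase p)
        popped := Function.update st.popped u (st.popped u ++ [p]) } with hst1
      -- By `tail`, had `v :: p` been discovered before, `p` would have been popped before, at `u`
      -- because a path determines its end node. But `p` was still queued, and `disc u` has no
      -- repetitions.
      have hnew : ∀ v ∈ I.G.out u, v :: p ∉ st1.disc v := by
        intro v hv hmem
        have hmem' : v :: p ∈ st.disc v := by
          by_cases hvu : v = u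
          · subst hvu
            simp only [hst1, IState.disc, Function.update_self, List.mem_append,
              List.mem_singleton] at hmem ⊢
            rcases hmem with (h1 | h1) | h1
            · exact Or.inl h1
            · exact absurd h1 (List.cons_ne_self _ _)
            · exact Or.inr (List.mem_of_mem_erase h1)
          · simpa [hst1, IState.disc, hvu] using hmem
        have hup := h.path u p (by simp [IState.disc, hpq])
        obtain ⟨l, rfl⟩ := hup.exists_cons
        rcases h.tail v _ hmem' with h1 | ⟨x, r, h1, -, h3⟩
        · simp at h1
        · obtain rfl : u :: l = r := by simpa using h1
          obtain ⟨l', hl'⟩ :=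
            (h.path x _ (List.mem_append_left _ h3)).exists_cons
          obtain ⟨rfl, -⟩ := List.cons.inj hl'
          exact hnp h3
      obtain ⟨h2, h3, h4, h5⟩ := hpop.foldlM_scan hN hNK hΔ (u := u) (p := p)
        (by simp [hst1]) hnew hk.le
      obtain rfl := Sum.inl.inj he
      refine ⟨⟨k, h2⟩, ?_⟩
      unfold IState.potential
      rw [h3, h4]
      have hsum : ∑ x, (st1.popped x).length * popBound I L N Δ x =
          ∑ x, (st.popped x).length * popBound I L N Δ x + popBound I L N Δ u := by
        rw [← Finset.add_sum_erase _ _ (Finset.mem_univ u),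
          ← Finset.add_sum_erase _ (fun x => (st.popped x).length * popBound I L N Δ x)
            (Finset.mem_univ u)]
        have : ∑ x ∈ Finset.univ.erase u, (st1.popped x).length * popBound I L N Δ x =
            ∑ x ∈ Finset.univ.erase u, (st.popped x).length * popBound I L N Δ x :=
          Finset.sum_congr rfl fun x hx => by simp [hst1, Finset.ne_of_mem_erase hx]
        rw [this]
        simp only [hst1, Function.update_self, List.length_append, List.length_singleton]
        ring
      rw [hsum]
      have hb : st1.numBest = st.numBest := rfl
      rw [hb] at h5
      have hi : st1.iter = st.iter := rfl
      rw [hi]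
      unfold popBound at *
      omega

/-- The times telescope along the potential. Once the output is returned there is no state left to
measure, so the uniform bound `M` takes over. -/
theorem idaqRun_spec (hN : I.nonDom L = N) (hNK : N * I.W ≤ I.K) (hΔ : ∀ v, I.G.inDeg v ≤ Δ)
    (M : ℕ) (hM : ∀ st d, Inv I L st d → st.potential L N Δ ≤ M) (t : ℕ) :
    (∀ st, (idaqRun I t).val = Sum.inl st → (∃ d, Inv I L st d) ∧
      (idaqRun I t).time ≤ (idaqInit I).time + st.potential L N Δ) ∧
    (∀ out, (idaqRun I t).val = Sum.inr out →
      (idaqRun I t).time ≤ (idaqInit I).time + M + I.K * adaptBound I L N Δ + 1) := by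
  induction t with
  | zero =>
    simp only [idaqRun, Timed.bind_val, Timed.bind_time, Timed.pure_val, Timed.pure_time]
    refine ⟨fun st h => ?_, fun _ h => by simp at h⟩
    obtain rfl := Sum.inl.inj h
    exact ⟨⟨0, idaqInit_inv I L⟩, Nat.le_add_right _ _⟩
  | succ t ih =>
    simp only [idaqRun, Timed.bind_val, Timed.bind_time]
    generalize idaqRun I t = r at ih ⊢
    obtain ⟨x, τ⟩ := r
    cases x with
    | inl st =>
      obtain ⟨⟨d, hd⟩, ht⟩ := ih.1 st rfl
      obtain ⟨h1, h2⟩ := hd.idaqStep hN hNK hΔ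
      dsimp only at ht ⊢
      refine ⟨fun st' h => ⟨(h1 st' h).1, ?_⟩, fun out h => ?_⟩
      · have := (h1 st' h).2
        omega
      · have := h2 out h
        have := hM st d hd
        omega
    | inr out =>
      refine ⟨fun _ h => by simp at h, fun _ _ => ?_⟩
      simpa using ih.2 out rfl

theorem idaqTime_le (hN : I.nonDom L = N) (hNK : N * I.W ≤ I.K) (hΔ : ∀ v, I.G.inDeg v ≤ Δ)
    (M : ℕ) (hM : ∀ st d, Inv I L st d → st.potential L N Δ ≤ M) :
    idaqTime I ≤ ((idaqInit I).time + M + I.K * adaptBound I L N Δ + 1 : ℕ) := by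
  refine iSup_le fun t => Nat.cast_le.2 ?_
  obtain ⟨h1, h2⟩ := idaqRun_spec hN hNK hΔ M hM t
  cases hx : (idaqRun I t).val with
  | inl st =>
    obtain ⟨⟨d, hd⟩, h3⟩ := h1 st hx
    have := hM st d hd
    omega
  | inr out => exact h2 out hx

end Idaq

/-! ### Total running time of IDAQ -/

section Idaq

variable {n : ℕ} {I : Problem n} {L N Δ : ℕ}

open Classical in
/-- The number of nodes that are not `L`-nodes. -/
noncomputable def Problem.numExc (I : Problem n) (L : ℕ) : ℕ :=
  (Finset.univ.filter fun v => v ∉ I.lNodes L).card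

theorem Inv.numBest_le {st : IState I} {d : ℝ} (h : Inv I L st d) : st.numBest ≤ I.numExc L := by
  classical
  unfold IState.numBest Problem.numExc
  refine Finset.card_le_card fun v hv => ?_
  simp only [Finset.mem_filter, Finset.mem_univ, true_and] at hv ⊢
  intro hvL
  simp [h.best v hvL] at hv

theorem Inv.sum_popped_le {st : IState I} {d : ℝ} (h : Inv I L st d) (hN : I.nonDom L = N) :
    ∑ u, (st.popped u).length ≤ n * N + I.numExc L * I.K := by
  classical
  have h1 : ∀ u, (st.popped u).length ≤ N + if u ∉ I.lNodes L then I.K else 0 := by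
    intro u
    by_cases hu : u ∈ I.lNodes L
    · have h2 : (st.popped u).length ≤ (st.disc u).length := by simp [IState.disc]
      exact (h2.trans (h.disc_length_le hN hu)).trans (Nat.le_add_right _ _)
    · rw [if_pos hu]
      exact (h.popped_length_le u).trans (Nat.le_add_left _ _)
  refine (Finset.sum_le_sum fun u _ => h1 u).trans ?_
  rw [Finset.sum_add_distrib, ← Finset.sum_filter]
  simp [Problem.numExc]

theorem adaptBound_le (I : Problem n) (L N Δ : ℕ) : adaptBound I L N Δ ≤
    2 + 2 * n + n * N * I.W + I.numExc L * (1 + Δ * I.K) * I.W := by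
  classical
  have h1 : ∀ v, 2 + discBound I L N Δ v * I.W ≤
      (2 + N * I.W) + if v ∉ I.lNodes L then (1 + Δ * I.K) * I.W else 0 := by
    intro v
    unfold discBound
    by_cases hv : v ∈ I.lNodes L
    · simp [hv]
    · rw [if_neg hv, if_pos hv]
      omega
  unfold adaptBound
  refine (Nat.add_le_add_left (Finset.sum_le_sum fun v _ => h1 v) _).trans ?_
  rw [Finset.sum_add_distrib, ← Finset.sum_filter]
  simp only [Finset.sum_const, Finset.card_univ, Fintype.card_fin, smul_eq_mul]
  rw [← Problem.numExc]
  apply le_of_eq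
  ring

/-- The part of `scanBound` that is relevant for all nodes. -/
def scanBoundMain (I : Problem n) (N : ℕ) : ℕ :=
  6 + 2 * I.W + 2 * Nat.log 2 n + 3 * N * I.W + N

/-- A bound on `scanBound` for the nodes that are not `L`-nodes. -/
def scanBoundExc (I : Problem n) (Δ : ℕ) : ℕ :=
  6 + 2 * I.W + 2 * Nat.log 2 n + 3 * (1 + Δ * I.K) * I.W + (1 + Δ * I.K) + (2 * I.K * I.W + I.K)

/-- Scanning a path to an exceptional node can cost a multiple of `K`, which must not be charged to
all of the up to `n * N` pops at `L`-nodes. Exchanging the sums counts these scans by target: an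
exceptional node has at most `Δ` predecessors, each popped at most `K` times. -/
theorem Inv.potential_le {st : IState I} {d : ℝ} (h : Inv I L st d) (hN : I.nonDom L = N)
    (hout : ∀ v, I.G.outDeg v ≤ Δ) (hin : ∀ v, I.G.inDeg v ≤ Δ) :
    st.potential L N Δ ≤ I.K * adaptBound I L N Δ +
      (n * N + I.numExc L * I.K) * (3 + Nat.log 2 n + Δ * scanBoundMain I N) +
      I.numExc L * (Δ * I.K * scanBoundExc I Δ) + bestBound I Δ * I.numExc L := by
  classical
  have hscan : ∀ v, scanBound I L N Δ v ≤
      scanBoundMain I N + if v ∉ I.lNodes L then scanBoundExc I Δ else 0 := by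
    intro v
    unfold scanBound scanBoundMain scanBoundExc discBound
    by_cases hv : v ∈ I.lNodes L
    · simp [hv]
    · rw [if_neg hv, if_neg hv, if_pos hv]
      omega
  have hpop : ∀ u, popBound I L N Δ u ≤ (3 + Nat.log 2 n + Δ * scanBoundMain I N) +
      ∑ v, if v ∈ I.G.out u then (if v ∉ I.lNodes L then scanBoundExc I Δ else 0) else 0 := by
    intro u
    unfold popBound
    rw [add_assoc (3 + Nat.log 2 n)]
    refine Nat.add_le_add_left ?_ _
    have h1 : ((I.G.out u).map (scanBound I L N Δ)).sum =
        ∑ v ∈ (I.G.out u).toFinset, scanBound I L N Δ v :=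
      (List.sum_toFinset _ (I.G.nodup u)).symm
    rw [h1]
    refine (Finset.sum_le_sum fun v _ => hscan v).trans ?_
    rw [Finset.sum_add_distrib, Finset.sum_const, smul_eq_mul]
    refine Nat.add_le_add ?_ ?_
    · exact Nat.mul_le_mul_right _ ((List.toFinset_card_le _).trans (hout u))
    · rw [← Finset.sum_filter (fun v => v ∈ I.G.out u)]
      refine le_of_eq (Finset.sum_congr ?_ fun _ _ => rfl)
      ext v
      simp
  have hexc : ∑ u, (st.popped u).length *
      (∑ v, if v ∈ I.G.out u then (if v ∉ I.lNodes L then scanBoundExc I Δ else 0) else 0) ≤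
      I.numExc L * (Δ * I.K * scanBoundExc I Δ) := by
    simp_rw [Finset.mul_sum]
    rw [Finset.sum_comm]
    have h1 : ∀ v, ∑ u, (st.popped u).length *
        (if v ∈ I.G.out u then (if v ∉ I.lNodes L then scanBoundExc I Δ else 0) else 0) ≤
        if v ∉ I.lNodes L then Δ * I.K * scanBoundExc I Δ else 0 := by
      intro v
      by_cases hv : v ∈ I.lNodes L
      · simp [hv]
      · simp_rw [if_pos hv, mul_ite, mul_zero]
        rw [← Finset.sum_filter]
        refine (Finset.sum_le_card_nsmul _ _ (I.K * scanBoundExc I Δ) fun u _ =>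
          Nat.mul_le_mul_right _ (h.popped_length_le u)).trans ?_
        rw [smul_eq_mul, mul_assoc]
        exact Nat.mul_le_mul_right _ (hin v)
    refine (Finset.sum_le_sum fun v _ => h1 v).trans ?_
    rw [← Finset.sum_filter, Finset.sum_const, smul_eq_mul, Problem.numExc]
  unfold IState.potential
  have h1 : ∑ u, (st.popped u).length * popBound I L N Δ u ≤
      (n * N + I.numExc L * I.K) * (3 + Nat.log 2 n + Δ * scanBoundMain I N) +
      I.numExc L * (Δ * I.K * scanBoundExc I Δ) := by
    refine (Finset.sum_le_sum fun u _ => Nat.mul_le_mul_left _ (hpop u)).trans ?_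
    rw [Finset.sum_congr rfl fun u _ => mul_add (st.popped u).length _ _, Finset.sum_add_distrib]
    refine Nat.add_le_add ?_ hexc
    rw [← Finset.sum_mul]
    exact Nat.mul_le_mul_right _ (h.sum_popped_le hN)
  have h2 := Nat.mul_le_mul_right (adaptBound I L N Δ) st.iter.isLt.le
  have h3 := Nat.mul_le_mul_left (bestBound I Δ) h.numBest_le
  omega

/-- An upper bound on the running time of IDAQ in terms of the parameters of the instance. -/
def idaqBound (n W K N Δ H l : ℕ) : ℕ :=
  n * Δ * W + (n + 1 + n * (1 + l + 2 * Δ)) + n + 1 +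
    2 * (K * (2 + 2 * n + n * N * W + H * (1 + Δ * K) * W)) +
    (n * N + H * K) * (3 + l + Δ * (6 + 2 * W + 2 * l + 3 * N * W + N)) +
    H * (Δ * K * (6 + 2 * W + 2 * l + 3 * (1 + Δ * K) * W + (1 + Δ * K) + (2 * K * W + K))) +
    (1 + Δ * K) * K * W * H + 1

theorem idaqTime_le_idaqBound (hN : I.nonDom L = N) (hNK : N * I.W ≤ I.K)
    (hout : ∀ v, I.G.outDeg v ≤ Δ) (hin : ∀ v, I.G.inDeg v ≤ Δ) :
    idaqTime I ≤ (idaqBound n I.W I.K N Δ (I.numExc L) (Nat.log 2 n) : ℕ) := by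
  refine (idaqTime_le hN hNK hin _ fun st d h => h.potential_le hN hout hin).trans ?_
  refine Nat.cast_le.2 ?_
  have h1 := idaqInit_time_le I hout
  have h2 := Nat.mul_le_mul_left I.K (adaptBound_le I L N Δ)
  unfold idaqBound
  unfold bestBound scanBoundMain scanBoundExc
  omega

theorem numExc_le (hn : 0 < n) (h : 1 - Real.log n / n ≤ I.alpha L) :
    (I.numExc L : ℝ) ≤ Real.log n := by
  classical
  have h1 : (I.lNodes L).ncard + I.numExc L = n := by
    have h2 : (I.lNodes L).ncard = (Finset.univ.filter fun v => v ∈ I.lNodes L).card := by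
      rw [← Set.ncard_coe_finset]; simp
    rw [h2, Problem.numExc, Finset.card_filter_add_card_filter_not]
    simp
  have h2 : ((I.lNodes L).ncard : ℝ) + I.numExc L = n := by exact_mod_cast h1
  have hn' : (0 : ℝ) < n := by exact_mod_cast hn
  unfold Problem.alpha at h
  rw [← sub_nonneg] at h
  have h3 : (I.lNodes L).ncard / (n : ℝ) - (1 - Real.log n / n) =
      ((I.lNodes L).ncard - n + Real.log n) / n := by field_simp; ring
  rw [h3] at h
  have := (div_nonneg_iff.1 h).resolve_right (by intro h; linarith [h.2])
  linarith [this.1]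

/-- Here `x` stands for `log n`, `r` for `√n`, `f` for `F n`, and `a` for a common bound on the
constants. Only `K * n * N * W` has the full order `r ^ 3 * f`; the other terms contain at most `r ^
2` up to logarithms and a factor `f`, or are `K * n`, and are absorbed by `x ^ 3 ≤ r` and `1 ≤ a *
f`. -/
theorem idaqBound_le {n W K N Δ H l : ℕ} {a x r f : ℝ} (ha : 1 ≤ a) (hx : 1 ≤ x) (hxr : x ^ 3 ≤ r)
    (hn : (n : ℝ) = r ^ 2) (hf : 1 ≤ a * f) (hfx : f ≤ x) (hW : (W : ℝ) ≤ a) (hΔ : (Δ : ℝ) ≤ a * x)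
    (hK : (K : ℝ) ≤ a * r) (hN : (N : ℝ) ≤ a * f) (hH : (H : ℝ) ≤ x) (hl : (l : ℝ) ≤ 2 * x) :
    (idaqBound n W K N Δ H l : ℝ) ≤ 100 * a ^ 6 * (r ^ 3 * f) := by
  have ha0 : 0 < a := by linarith
  have hx0 : 0 < x := by linarith
  have hr1 : 1 ≤ r := (one_le_pow₀ hx).trans hxr
  have hr0 : 0 < r := by linarith
  have hyx : a * f ≤ a * x := by gcongr
  set y := a * f with hy
  have hy0 : 0 < y := by linarith
  have mon : ∀ i j k : ℕ, i ≤ 5 → j ≤ 3 → k ≤ 2 → a ^ i * x ^ j * r ^ k ≤ a ^ 5 * r ^ 3 := by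
    intro i j k hi hj hk
    calc a ^ i * x ^ j * r ^ k ≤ a ^ 5 * x ^ 3 * r ^ 2 := by gcongr
      _ ≤ a ^ 5 * r * r ^ 2 := by gcongr
      _ = a ^ 5 * r ^ 3 := by ring
  have mon1 : ∀ i j k : ℕ, i ≤ 5 → j ≤ 3 → k ≤ 2 → a ^ i * x ^ j * r ^ k ≤ a ^ 5 * r ^ 3 * y :=
    fun i j k hi hj hk => (mon i j k hi hj hk).trans (le_mul_of_one_le_right (by positivity) hf)
  have small : ∀ i j k : ℕ, 1 ≤ a ^ i * x ^ j * r ^ k := fun i j k =>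
    one_le_mul_of_one_le_of_one_le (one_le_mul_of_one_le_of_one_le (one_le_pow₀ ha)
      (one_le_pow₀ hx)) (one_le_pow₀ hr1)
  have hD : (1 + Δ * K : ℝ) ≤ 2 * (a ^ 2 * x * r) := by
    have h1 : (Δ * K : ℝ) ≤ (a * x) * (a * r) := by gcongr
    have h2 := small 2 1 1
    linarith
  have t1 : (n * Δ * W : ℝ) ≤ a ^ 5 * r ^ 3 * y := by
    calc (n * Δ * W : ℝ) ≤ r ^ 2 * (a * x) * a := by rw [hn]; gcongr
      _ = a ^ 2 * x ^ 1 * r ^ 2 := by ring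
      _ ≤ _ := mon1 2 1 2 (by norm_num) (by norm_num) (by norm_num)
  have t2 : (n + 1 + n * (1 + l + 2 * Δ) + n + 1 : ℝ) ≤ 9 * (a ^ 5 * r ^ 3 * y) := by
    calc (n + 1 + n * (1 + l + 2 * Δ) + n + 1 : ℝ)
        ≤ r ^ 2 + 1 + r ^ 2 * (1 + 2 * x + 2 * (a * x)) + r ^ 2 + 1 := by rw [hn]; gcongr
      _ = 2 + 3 * (a ^ 0 * x ^ 0 * r ^ 2) + 2 * (a ^ 0 * x ^ 1 * r ^ 2) +
          2 * (a ^ 1 * x ^ 1 * r ^ 2) := by ring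
      _ ≤ _ := by
        have h0 := (small 0 0 2).trans (mon1 0 0 2 (by norm_num) (by norm_num) (by norm_num))
        have h1 := mon1 0 0 2 (by norm_num) (by norm_num) (by norm_num)
        have h2 := mon1 0 1 2 (by norm_num) (by norm_num) (by norm_num)
        have h3 := mon1 1 1 2 (by norm_num) (by norm_num) (by norm_num)
        linarith
  have t3 : (2 * (K * (2 + 2 * n + n * N * W + H * (1 + Δ * K) * W)) : ℝ) ≤
      14 * (a ^ 5 * r ^ 3 * y) := by
    have h1 : (2 + 2 * n + n * N * W + H * (1 + Δ * K) * W : ℝ) ≤ 7 * (a ^ 4 * r ^ 2 * y) := by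
      have e1 : (n * N * W : ℝ) ≤ a ^ 4 * r ^ 2 * y := by
        calc (n * N * W : ℝ) ≤ r ^ 2 * y * a := by rw [hn]; gcongr
          _ = a ^ 1 * r ^ 2 * y := by ring
          _ ≤ _ := by gcongr; norm_num
      have e2 : (H * (1 + Δ * K) * W : ℝ) ≤ 2 * (a ^ 4 * r ^ 2 * y) := by
        calc (H * (1 + Δ * K) * W : ℝ) ≤ x * (2 * (a ^ 2 * x * r)) * a := by gcongr
          _ = 2 * (a ^ 3 * x ^ 2 * r) := by ring
          -- The power of `x` is raised only to make `hxr` applicable.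
          _ ≤ 2 * (a ^ 4 * x ^ 3 * r) := by gcongr <;> norm_num
          _ ≤ 2 * (a ^ 4 * r * r) := by gcongr
          _ = 2 * (a ^ 4 * r ^ 2) := by ring
          _ ≤ _ := by
            exact mul_le_mul_of_nonneg_left (le_mul_of_one_le_right (by positivity) hf) two_pos.le
      have e3 : r ^ 2 ≤ a ^ 4 * r ^ 2 * y := by
        calc r ^ 2 = 1 * r ^ 2 * 1 := by ring
          _ ≤ _ := by gcongr; exact one_le_pow₀ ha
      have e4 : 1 ≤ r ^ 2 := one_le_pow₀ hr1
      rw [hn]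
      rw [hn] at e1
      linarith
    calc (2 * (K * (2 + 2 * n + n * N * W + H * (1 + Δ * K) * W)) : ℝ)
        ≤ 2 * ((a * r) * (7 * (a ^ 4 * r ^ 2 * y))) := by gcongr
      _ = _ := by ring
  have t4 : ((n * N + H * K) * (3 + l + Δ * (6 + 2 * W + 2 * l + 3 * N * W + N)) : ℝ) ≤
      42 * (a ^ 5 * r ^ 3 * y) := by
    have e1 : (n * N + H * K : ℝ) ≤ 2 * (a * r ^ 2 * y) := by
      have e2 : (n * N : ℝ) ≤ a * r ^ 2 * y := by
        calc (n * N : ℝ) ≤ 1 * r ^ 2 * y := by rw [hn, one_mul]; gcongr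
          _ ≤ _ := by gcongr
      have e3 : (H * K : ℝ) ≤ a * r ^ 2 * y := by
        calc (H * K : ℝ) ≤ x * (a * r) := by gcongr
          _ = a * x ^ 1 * r := by ring
          _ ≤ a * x ^ 3 * r := by gcongr; norm_num
          _ ≤ a * r * r := by gcongr
          _ = a * r ^ 2 := by ring
          _ ≤ _ := le_mul_of_one_le_right (by positivity) hf
      linarith
    have e2 : (6 + 2 * W + 2 * l + 3 * N * W + N : ℝ) ≤ 16 * (a ^ 2 * x) := by
      calc (6 + 2 * W + 2 * l + 3 * N * W + N : ℝ)
          ≤ 6 + 2 * a + 2 * (2 * x) + 3 * (a * x) * a + a * x := by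
            gcongr
            · exact hN.trans hyx
            · exact hN.trans hyx
        _ ≤ _ := by
          have h1 : a ≤ a ^ 2 := by nlinarith
          have h2 : a * x ≤ a ^ 2 * x := by gcongr
          have h3 : a * 1 ≤ a * x := by gcongr
          have h4 : 1 * x ≤ a * x := by gcongr
          nlinarith
    have e3 : (3 + l + Δ * (6 + 2 * W + 2 * l + 3 * N * W + N) : ℝ) ≤ 21 * (a ^ 3 * x ^ 2) := by
      have h1 : (Δ * (6 + 2 * W + 2 * l + 3 * N * W + N) : ℝ) ≤ (a * x) * (16 * (a ^ 2 * x)) := by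
        gcongr
      have h2 : x ≤ a ^ 3 * x ^ 2 := by
        calc x = 1 * x ^ 1 := by ring
          _ ≤ _ := by gcongr; exacts [one_le_pow₀ ha, one_le_two]
      linarith
    calc ((n * N + H * K) * (3 + l + Δ * (6 + 2 * W + 2 * l + 3 * N * W + N)) : ℝ)
        ≤ (2 * (a * r ^ 2 * y)) * (21 * (a ^ 3 * x ^ 2)) := by gcongr
      _ = 42 * (a ^ 4 * x ^ 2 * r ^ 2) * y := by ring
      _ ≤ 42 * (a ^ 5 * r ^ 3) * y := by
        gcongr ?_ * _
        exact mul_le_mul_of_nonneg_left (mon 4 2 2 (by norm_num) (by norm_num) (by norm_num))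
          (by norm_num)
      _ = _ := by ring
  have t5 : (H * (Δ * K * (6 + 2 * W + 2 * l + 3 * (1 + Δ * K) * W + (1 + Δ * K) +
      (2 * K * W + K))) : ℝ) ≤ 23 * (a ^ 5 * r ^ 3 * y) := by
    have e1 : (6 + 2 * W + 2 * l + 3 * (1 + Δ * K) * W + (1 + Δ * K) + (2 * K * W + K) : ℝ) ≤
        23 * (a ^ 3 * x * r) := by
      calc (6 + 2 * W + 2 * l + 3 * (1 + Δ * K) * W + (1 + Δ * K) + (2 * K * W + K) : ℝ)
          ≤ 6 + 2 * a + 2 * (2 * x) + 3 * (2 * (a ^ 2 * x * r)) * a + 2 * (a ^ 2 * x * r) +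
            (2 * (a * r) * a + a * r) := by gcongr
        _ = 6 + 2 * (a ^ 1 * x ^ 0 * r ^ 0) + 4 * (a ^ 0 * x ^ 1 * r ^ 0) + 6 * (a ^ 3 * x ^ 1 * r ^ 1)
            + 2 * (a ^ 2 * x ^ 1 * r ^ 1) + 2 * (a ^ 2 * x ^ 0 * r ^ 1) +
            a ^ 1 * x ^ 0 * r ^ 1 := by ring
        _ ≤ _ := by
          have m2 : ∀ i j k : ℕ, i ≤ 3 → j ≤ 1 → k ≤ 1 →
              a ^ i * x ^ j * r ^ k ≤ a ^ 3 * x * r := by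
            intro i j k hi hj hk
            calc a ^ i * x ^ j * r ^ k ≤ a ^ 3 * x ^ 1 * r ^ 1 := by gcongr
              _ = _ := by ring
          have h0 := (small 0 0 0).trans (m2 0 0 0 (by norm_num) (by norm_num) (by norm_num))
          have h1 := m2 1 0 0 (by norm_num) (by norm_num) (by norm_num)
          have h2 := m2 0 1 0 (by norm_num) (by norm_num) (by norm_num)
          have h3 := m2 3 1 1 (by norm_num) (by norm_num) (by norm_num)
          have h4 := m2 2 1 1 (by norm_num) (by norm_num) (by norm_num)
          have h5 := m2 2 0 1 (by norm_num) (by norm_num) (by norm_num)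
          have h6 := m2 1 0 1 (by norm_num) (by norm_num) (by norm_num)
          linarith
    calc (H * (Δ * K * (6 + 2 * W + 2 * l + 3 * (1 + Δ * K) * W + (1 + Δ * K) +
          (2 * K * W + K))) : ℝ) ≤ x * ((a * x) * (a * r) * (23 * (a ^ 3 * x * r))) := by gcongr
      _ = 23 * (a ^ 5 * x ^ 3 * r ^ 2) := by ring
      _ ≤ _ := mul_le_mul_of_nonneg_left (mon1 5 3 2 (by norm_num) (by norm_num) (by norm_num))
          (by norm_num)
  have t6 : ((1 + Δ * K) * K * W * H : ℝ) ≤ 2 * (a ^ 5 * r ^ 3 * y) := by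
    calc ((1 + Δ * K) * K * W * H : ℝ) ≤ 2 * (a ^ 2 * x * r) * (a * r) * a * x := by gcongr
      _ = 2 * (a ^ 4 * x ^ 2 * r ^ 2) := by ring
      _ ≤ _ := mul_le_mul_of_nonneg_left (mon1 4 2 2 (by norm_num) (by norm_num) (by norm_num))
          (by norm_num)
  have t7 : 1 ≤ a ^ 5 * r ^ 3 * y :=
    (small 0 0 0).trans (mon1 0 0 0 (by norm_num) (by norm_num) (by norm_num))
  -- The coefficients in `t1` to `t7` add up to 92.
  have e : 100 * a ^ 6 * (r ^ 3 * f) = 100 * (a ^ 5 * r ^ 3 * y) := by rw [hy]; ring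
  rw [e]
  unfold idaqBound
  push_cast
  linarith

end Idaq

/-! ## Complete binary trees, on which the Standard Algorithm is slow -/

/-- The complete binary tree with root `0`, in which the children of `u` are `2 * u + 1` and
`2 * u + 2`. The length of the edge from `u` to `v` is `v - u`, so that `v` has distance `v` from
the root. -/
noncomputable def treeGraph (n : ℕ) : MOG n 1 where
  out u := (List.finRange n).filter fun v => v.val ≠ 0 ∧ (v.val - 1) / 2 = u.val
  nodup u := (List.nodup_finRange n).filter _
  w u v _ := (v.val : ℝ) - u.val
  w_nonneg u v hv j := by
    have hv' : v.val ≠ 0 ∧ (v.val - 1) / 2 = u.val := by simpa using hv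
    rw [sub_nonneg, Nat.cast_le]
    omega

section Tree

variable {n : ℕ}

theorem mem_treeGraph_out {u v : Fin n} :
    v ∈ (treeGraph n).out u ↔ v.val ≠ 0 ∧ (v.val - 1) / 2 = u.val := by
  simp [treeGraph]

theorem treeGraph_outDeg_le (u : Fin n) : (treeGraph n).outDeg u ≤ 2 := by
  unfold MOG.outDeg
  rw [← List.toFinset_card_of_nodup ((treeGraph n).nodup u),
    ← Finset.card_map (Fin.valEmbedding)]
  refine le_trans (Finset.card_le_card (t := {2 * u.val + 1, 2 * u.val + 2}) fun x hx => ?_)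
    Finset.card_le_two
  simp only [Finset.mem_map, List.mem_toFinset, mem_treeGraph_out, Fin.valEmbedding_apply] at hx
  obtain ⟨v, hv, rfl⟩ := hx
  simp only [Finset.mem_insert, Finset.mem_singleton]
  omega

theorem treeGraph_inDeg_le (v : Fin n) :
    (treeGraph n).inDeg v ≤ if v.val = 0 then 0 else 1 := by
  unfold MOG.inDeg
  simp only [mem_treeGraph_out]
  split_ifs with h
  · simp [h]
  · refine Finset.card_le_one.2 fun a ha b hb => ?_
    simp only [Finset.mem_filter, Finset.mem_univ, true_and] at ha hb
    exact Fin.ext (ha.2.symm.trans hb.2)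

theorem treeGraph_reach {s : Fin n} (hs : s.val = 0) (v : Fin n) :
    ∃ p, (treeGraph n).IsPath s v p := by
  obtain ⟨k, hk⟩ := v
  induction k using Nat.strong_induction_on with
  | _ k ih =>
    by_cases h0 : k = 0
    · subst h0
      obtain rfl : s = ⟨0, hk⟩ := Fin.ext hs
      exact ⟨_, .start⟩
    · obtain ⟨p, hp⟩ := ih ((k - 1) / 2) (by omega) (by omega)
      exact ⟨_, hp.step (mem_treeGraph_out.2 ⟨h0, rfl⟩)⟩

/-- The root has no incoming edge, and the last edge of a path to any other node comes from its
parent. -/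
theorem treeGraph_path_unique {s : Fin n} (hs : s.val = 0) {v : Fin n} {p q : Path n}
    (hp : (treeGraph n).IsPath s v p) (hq : (treeGraph n).IsPath s v q) : p = q := by
  induction hp generalizing q with
  | start =>
    cases hq with
    | start => rfl
    | step _ h => exact absurd hs (mem_treeGraph_out.1 h).1
  | step hp h ih =>
    cases hq with
    | start => exact absurd hs (mem_treeGraph_out.1 h).1
    | step hq h' =>
      have h2 := (mem_treeGraph_out.1 h).2
      rw [(mem_treeGraph_out.1 h').2] at h2
      obtain rfl := Fin.ext h2
      rw [ih hq]

theorem treeGraph_edgeCost (lam : Fin 1 → ℝ) (u v : Fin n) :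
    (treeGraph n).edgeCost lam u v = lam 0 * ((v.val : ℝ) - u.val) := by
  simp [MOG.edgeCost, treeGraph]

/-- The state of Dijkstra's algorithm on the binary tree after `t` nodes have been settled. -/
structure TreeInv (c : ℝ) (t : ℕ) (st : DState n) : Prop where
  settled : ∀ v : Fin n, (st.settled v).isSome ↔ v.val < t
  heap : ∀ v : Fin n, (st.heap v).map Prod.fst =
    if t ≤ v.val ∧ v.val < 2 * t + 1 then some (c * v.val) else none

theorem TreeInv.heap_size {c : ℝ} {t : ℕ} {st : DState n} (h : TreeInv c t st)
    (ht : 2 * t + 1 ≤ n) : t + 1 ≤ st.heap.size := by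
  unfold Heap.size
  rw [← Finset.card_map (Fin.valEmbedding)]
  have h1 : t + 1 = (Finset.Ico t (2 * t + 1)).card := by rw [Nat.card_Ico]; omega
  rw [h1]
  refine Finset.card_le_card fun x hx => ?_
  rw [Finset.mem_Ico] at hx
  simp only [Finset.mem_map, Finset.mem_filter, Finset.mem_univ, true_and, Fin.valEmbedding_apply]
  refine ⟨⟨x, by omega⟩, ?_, rfl⟩
  have h2 := h.heap ⟨x, by omega⟩
  rw [if_pos hx] at h2
  cases h3 : st.heap ⟨x, by omega⟩ with
  | none => rw [h3] at h2; simp at h2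
  | some _ => rfl

/-- Keys are proportional to node numbers, so the minimum is at node `t`; its children `2 * t + 1`
and `2 * t + 2`, when they exist, extend the interval of heap nodes. -/
theorem TreeInv.dijkstraStep {lam : Fin 1 → ℝ} (hl : 0 < lam 0) {t : ℕ} {st : DState n}
    (h : TreeInv (lam 0) t st) (ht : t < n) :
    TreeInv (lam 0) (t + 1)
      (dijkstraStep (treeGraph n) ((treeGraph n).edgeCost lam) st).val := by
  classical
  unfold MOWSP.dijkstraStep
  simp only [Timed.bind_val]
  have h0 := h.heap ⟨t, ht⟩
  rw [if_pos ⟨le_rfl, by dsimp only; omega⟩] at h0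
  obtain ⟨⟨k0, p0⟩, hk0, hk0'⟩ := Option.map_eq_some_iff.1 h0
  dsimp only at hk0'
  split
  · rename_i hn
    rw [Heap.deleteMin_eq_none hn] at hk0
    cases hk0
  · rename_i u d p H hm
    obtain ⟨hu, rfl, hmin⟩ := Heap.deleteMin_eq_some hm
    have h1 := h.heap u
    rw [hu] at h1
    split_ifs at h1 with hut
    · simp only [Option.map_some, Option.some.injEq] at h1
      have h2 := hmin _ _ _ hk0
      rw [hk0', h1] at h2
      have h3 : u.val = t := by
        have := le_of_mul_le_mul_left h2 hl
        have : u.val ≤ t := by exact_mod_cast this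
        omega
      subst h1
      have key := Timed.foldlM_rule
        (f := relax ((treeGraph n).edgeCost lam) u (lam 0 * u.val) p)
        (fun l st' _ => l.Nodup ∧ (∀ v ∈ l, v ∈ (treeGraph n).out u) ∧
          (∀ v : Fin n, (st'.settled v).isSome ↔ v.val < t + 1) ∧
          ∀ v : Fin n, (st'.heap v).map Prod.fst =
            if (t + 1 ≤ v.val ∧ v.val < 2 * t + 1) ∨ (v ∈ (treeGraph n).out u ∧ v ∉ l) then
              some (lam 0 * v.val) else none)
        (by
          rintro a l st' τ ⟨hnd, hl', hs, hh⟩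
          obtain ⟨ha, hnd⟩ := List.nodup_cons.1 hnd
          obtain ⟨hl1, hl2⟩ := List.forall_mem_cons.1 hl'
          have ha' := mem_treeGraph_out.1 hl1
          refine ⟨hnd, hl2, by rw [relax_settled]; exact hs, fun v => ?_⟩
          -- A child of `t` is at least `2 * t + 1`, so it is neither settled nor in the heap yet
          -- and relaxation inserts it.
          have hha := hh a
          rw [if_neg (by
            rintro (h | h)
            · omega
            · exact h.2 List.mem_cons_self), Option.map_eq_none_iff] at hha
          rw [relax_heap, if_neg (by
            rintro (h | ⟨k, q, h, -⟩)
            · have := (hs a).1 h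
              omega
            · rw [hha] at h; cases h)]
          by_cases hva : v = a
          · subst hva
            rw [if_pos (Or.inr ⟨hl1, ha⟩), Function.update_self, treeGraph_edgeCost]
            simp only [Option.map_some, Option.some.injEq]
            ring
          · rw [Function.update_of_ne hva, hh v]
            simp [hva]) ((treeGraph n).out u)
        ⟨Function.update st.heap u none, Function.update st.settled u (some p)⟩ 0
        ⟨(treeGraph n).nodup u, fun _ h => h, by
          intro v
          by_cases hvu : v = u
          · subst hvu; simp [h3]
          · have : v.val ≠ t := fun h => hvu (Fin.ext (h.trans h3.symm))
            simp only [Function.update_of_ne hvu]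
            rw [h.settled v]
            omega, by
          intro v
          by_cases hvu : v = u
          · subst hvu
            simp [h3]
          · have : v.val ≠ t := fun h => hvu (Fin.ext (h.trans h3.symm))
            simp only [Function.update_of_ne hvu]
            rw [h.heap v]
            refine if_congr ?_ rfl rfl
            constructor
            · intro h; left; omega
            · rintro (h | h)
              · omega
              · exact absurd h.1 h.2⟩
      obtain ⟨-, -, h4, h5⟩ := key
      refine ⟨h4, fun v => (h5 v).trans (if_congr ?_ rfl rfl)⟩
      rw [mem_treeGraph_out]
      simp only [List.not_mem_nil, not_false_eq_true, and_true]
      omega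
    · simp at h1

theorem treeGraph_dijkstra_time {lam : Fin 1 → ℝ} (hl : 0 < lam 0) {s : Fin n} (hs : s.val = 0) :
    (n / 4) * Nat.log 2 (n / 4) ≤
      (dijkstra (treeGraph n) ((treeGraph n).edgeCost lam) s).time := by
  unfold dijkstra
  simp only [Timed.bind_time, Timed.tick_time, Timed.pure_time, Heap.insert, Timed.bind_val,
    Timed.pure_val]
  have key := Timed.foldlM_rule
      (f := fun st (_ : ℕ) => dijkstraStep (treeGraph n) ((treeGraph n).edgeCost lam) st)
      (fun l st τ => ∃ t, t + l.length = n ∧ TreeInv (lam 0) t st ∧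
        -- With truncated subtraction, this counts the steps so far whose index lies in `[n / 4, 2 *
        -- (n / 4))`. There the heap has more than `n / 4` entries, and `2 * t + 1 ≤ n` holds.
        (min t (2 * (n / 4)) - n / 4) * Nat.log 2 (n / 4) ≤ τ)
      (by
        rintro a l st τ ⟨t, ht, hi, hτ⟩
        simp only [List.length_cons] at ht
        refine ⟨t + 1, by omega, hi.dijkstraStep hl (by omega), ?_⟩
        by_cases hc : n / 4 ≤ t ∧ t < 2 * (n / 4)
        · have h1 := hi.heap_size (by omega)
          have h2 : Nat.log 2 (n / 4) ≤ Nat.log 2 st.heap.size := Nat.log_mono_right (by omega)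
          have h3 : Nat.log 2 st.heap.size ≤
              (dijkstraStep (treeGraph n) ((treeGraph n).edgeCost lam) st).time := by
            unfold MOWSP.dijkstraStep
            simp only [Timed.bind_time, Heap.deleteMin_time_eq]
            omega
          have h4 : min (t + 1) (2 * (n / 4)) - n / 4 = min t (2 * (n / 4)) - n / 4 + 1 := by omega
          rw [h4, add_mul, one_mul]
          omega
        · have h4 : min (t + 1) (2 * (n / 4)) - n / 4 = min t (2 * (n / 4)) - n / 4 := by omega
          rw [h4]
          omega) (List.range n)
      ⟨Function.update Heap.empty s (some (0, [s])), fun _ => none⟩ 0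
      ⟨0, by simp, ⟨by simp, fun v => by
        by_cases hv : v = s
        · subst hv; simp [hs]
        · have : v.val ≠ 0 := fun h => hv (Fin.ext (h.trans hs.symm))
          simp [hv, Heap.empty, this]⟩, by simp⟩
  obtain ⟨t, ht, -, h1⟩ := key
  simp only [List.length_nil, add_zero] at ht
  have h2 : min t (2 * (n / 4)) - n / 4 = n / 4 := by omega
  rw [h2] at h1
  omega

/-- The binary tree with `K` coefficient vectors. -/
noncomputable def treeProblem (n K : ℕ) (hn : 0 < n) (hK : 0 < K) : Problem n where
  W := 1
  W_pos := one_pos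
  K := K
  K_pos := hK
  G := treeGraph n
  s := ⟨0, hn⟩
  reach := treeGraph_reach rfl
  coef i _ := i.val + 1
  coef_pos i _ := by positivity
  coef_inj i j h := by
    have := congrFun h 0
    simp only [add_left_inj, Nat.cast_inj] at this
    exact Fin.ext this

theorem treeProblem_standardTime {K : ℕ} (hn : 0 < n) (hK : 0 < K) :
    K * ((n / 4) * Nat.log 2 (n / 4)) ≤ standardTime (treeProblem n K hn hK) := by
  unfold standardTime standard
  have key := Timed.foldlM_rule
    (f := fun acc (i : Fin K) => (do
      let c ← weigh (treeProblem n K hn hK).G ((treeProblem n K hn hK).coef i)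
      let P ← dijkstra (treeProblem n K hn hK).G c (treeProblem n K hn hK).s
      return acc ++ [P] : Timed (List (Fin n → Option (Path n)))))
    (fun l _ τ => K * ((n / 4) * Nat.log 2 (n / 4)) ≤ τ + l.length * ((n / 4) * Nat.log 2 (n / 4)))
    (by
      rintro a l acc τ h
      have : n / 4 * Nat.log 2 (n / 4) ≤ (dijkstra (treeProblem n K hn hK).G
          ((treeProblem n K hn hK).G.edgeCost ((treeProblem n K hn hK).coef a))
          (treeProblem n K hn hK).s).time :=
        treeGraph_dijkstra_time (n := n) (lam := fun _ => a.val + 1) (by positivity)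
          (s := ⟨0, hn⟩) rfl
      simp only [List.length_cons, add_mul, one_mul] at h
      simp only [Timed.bind_time, weigh, Timed.bind_val, Timed.pure_val, Timed.pure_time]
      omega) (List.finRange K) [] 0 (by simp)
  simp only [List.length_nil, zero_mul, add_zero, zero_add] at key
  exact key

end Tree

/-! ## Admissible instances -/

section Admissible

variable {n : ℕ} {I : Problem n}

theorem MOG.numEdges_eq_sum_inDeg {W : ℕ} (G : MOG n W) : G.numEdges = ∑ v, G.inDeg v := by
  have h1 : ∀ u, (G.out u).length = ∑ v, if v ∈ G.out u then 1 else 0 := by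
    intro u
    rw [← List.toFinset_card_of_nodup (G.nodup u), ← Finset.sum_filter, Finset.card_eq_sum_ones]
    refine Finset.sum_congr ?_ fun _ _ => rfl
    ext v
    simp
  unfold MOG.numEdges MOG.inDeg
  simp_rw [h1, Finset.card_filter]
  exact Finset.sum_comm

theorem Problem.one_le_inDeg (I : Problem n) {v : Fin n} (hv : v ≠ I.s) : 1 ≤ I.G.inDeg v := by
  obtain ⟨p, hp⟩ := I.reach v
  cases hp with
  | start => exact absurd rfl hv
  | @step u _ _ _ he => exact Finset.card_pos.2 ⟨u, by simpa using he⟩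

/-- In any instance each node other than the start has an incoming edge, so there are at least `n -
1` edges, and the tree has no more. -/
theorem treeGraph_numEdges_le (I : Problem n) (hn : 0 < n) :
    (treeGraph n).numEdges ≤ I.G.numEdges := by
  have h1 : (treeGraph n).numEdges ≤ n - 1 := by
    rw [MOG.numEdges_eq_sum_inDeg]
    refine (Finset.sum_le_sum fun v _ => treeGraph_inDeg_le v).trans ?_
    have : ∀ v : Fin n, (if v.val = 0 then 0 else 1) = if v ≠ ⟨0, hn⟩ then 1 else 0 := by
      intro v
      by_cases h : v.val = 0
      · simp [h, Fin.ext_iff]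
      · simp [h, Fin.ext_iff]
    simp_rw [this]
    rw [← Finset.card_filter, Finset.filter_ne', Finset.card_erase_of_mem (Finset.mem_univ _)]
    simp
  have h2 : n - 1 ≤ I.G.numEdges := by
    rw [MOG.numEdges_eq_sum_inDeg]
    have : ∑ v, (if v ≠ I.s then 1 else 0) ≤ ∑ v, I.G.inDeg v := by
      refine Finset.sum_le_sum fun v _ => ?_
      split_ifs with h
      · exact I.one_le_inDeg h
      · exact Nat.zero_le _
    rw [← Finset.card_filter, Finset.filter_ne', Finset.card_erase_of_mem (Finset.mem_univ _)] at this
    simpa using this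
  exact h1.trans h2

/-- There may be infinitely many paths to `v`; a cheapest one, as found by Dijkstra's algorithm, is
Pareto. -/
theorem Problem.exists_isPareto (I : Problem n) (v : Fin n) : ∃ p, I.IsPareto v p := by
  obtain ⟨p, -, hp, hmin⟩ := dijkstra_correct (I.coef_pos ⟨0, I.K_pos⟩) I.reach v
  exact ⟨p, isPareto_of_minimal hp hmin⟩

theorem Problem.lNodes_zero (I : Problem n) : I.lNodes 0 = ∅ := by
  refine Set.eq_empty_of_forall_notMem fun v hv => ?_
  obtain ⟨p, hp⟩ := I.exists_isPareto v
  have h : {p | I.IsPareto v p}.encard ≤ (0 : ℕ) := hv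
  rw [Nat.cast_zero, nonpos_iff_eq_zero, Set.encard_eq_zero] at h
  exact Set.notMem_empty p (h ▸ hp)

theorem Problem.alpha_zero (I : Problem n) : I.alpha 0 = 0 := by
  simp [Problem.alpha, I.lNodes_zero]

theorem one_sub_log_div_pos (hn : 0 < n) : 0 < 1 - Real.log n / n := by
  have hn' : (0 : ℝ) < n := by exact_mod_cast hn
  rw [sub_pos, div_lt_one hn']
  linarith [Real.log_le_sub_one_of_pos hn']

theorem Problem.IsL.pos {L : ℕ} (h : I.IsL L) (hn : 0 < n) : 1 ≤ L := by
  rcases Nat.eq_zero_or_pos L with rfl | h0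
  · have h1 : 1 - Real.log n / n ≤ I.alpha 0 := h.1
    rw [I.alpha_zero] at h1
    exact absurd h1 (one_sub_log_div_pos hn).not_ge
  · exact h0

/-- By minimality of `L`, some `L`-node is the end of more than `L - 1` Pareto paths, and no Pareto
path dominates another. -/
theorem Problem.IsL.le_nonDom {L N : ℕ} (h : I.IsL L) (hn : 0 < n) (hN : I.nonDom L = N) :
    L ≤ N := by
  have hL := h.pos hn
  have h1 : ∃ v ∈ I.lNodes L, v ∉ I.lNodes (L - 1) := by
    by_contra hc
    push Not at hc
    have h2 : I.lNodes (L - 1) = I.lNodes L := by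
      refine Set.Subset.antisymm (fun v hv => ?_) hc
      exact le_trans (show _ ≤ ((L - 1 : ℕ) : ℕ∞) from hv) (Nat.cast_le.2 (Nat.sub_le _ _))
    have h3 : L ≤ L - 1 := h.2 (show 1 - Real.log n / n ≤ I.alpha (L - 1) by
      rw [Problem.alpha, h2]; exact h.1)
    omega
  obtain ⟨v, hv, hv'⟩ := h1
  have h2 : ((L - 1 : ℕ) : ℕ∞) < {p | I.IsPareto v p}.encard := not_le.1 hv'
  obtain ⟨p, hp⟩ := I.exists_isPareto v
  have h3 : {q | I.G.IsPath I.s v q ∧ ¬ Dominates (I.G.obj p) (I.G.obj q)}.encard ≤ N :=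
    hN ▸ I.encard_le_nonDom hv hp
  have h4 : {p | I.IsPareto v p}.encard ≤
      {q | I.G.IsPath I.s v q ∧ ¬ Dominates (I.G.obj p) (I.G.obj q)}.encard :=
    Set.encard_le_encard fun q hq => ⟨hq.1, hq.2 p hp.1⟩
  have h5 : ((L - 1 : ℕ) : ℕ∞) < (N : ℕ∞) := h2.trans_le (h4.trans h3)
  have h6 : L - 1 < N := by exact_mod_cast h5
  omega

variable {K : ℕ} {hn : 0 < n} {hK : 0 < K}

theorem treeProblem_isL : (treeProblem n K hn hK).IsL 1 := by
  have hn' : (0 : ℝ) < n := by exact_mod_cast hn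
  refine ⟨?_, fun l hl => ?_⟩
  · have h1 : (treeProblem n K hn hK).lNodes 1 = Set.univ := by
      refine Set.eq_univ_of_forall fun v => ?_
      have h : {p | (treeProblem n K hn hK).IsPareto v p}.encard ≤ 1 :=
        Set.encard_le_one_iff.2 fun p q hp hq => treeGraph_path_unique rfl hp.1 hq.1
      simpa [Problem.lNodes] using h
    change 1 - Real.log n / n ≤ Problem.alpha _ 1
    rw [Problem.alpha, h1, Set.ncard_univ, Nat.card_fin, div_self hn'.ne']
    have : 0 ≤ Real.log n / n := div_nonneg (Real.log_natCast_nonneg n) hn'.le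
    linarith
  · rcases Nat.eq_zero_or_pos l with rfl | h0
    · have h1 : 1 - Real.log n / n ≤ (treeProblem n K hn hK).alpha 0 := hl
      rw [Problem.alpha_zero] at h1
      exact absurd h1 (one_sub_log_div_pos hn).not_ge
    · exact h0

theorem treeProblem_nonDom : (treeProblem n K hn hK).nonDom 1 = (1 : ℕ) := by
  have h1 : (treeProblem n K hn hK).nonDom 1 ≤ (1 : ℕ) := by
    refine iSup₂_le fun v _ => iSup₂_le fun p _ => ?_
    exact Set.encard_le_one_iff.2 fun p q hp hq => treeGraph_path_unique rfl hp.1 hq.1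
  obtain ⟨N, hN⟩ := ENat.ne_top_iff_exists.1 (ne_top_of_le_ne_top (ENat.natCast_ne_top 1) h1)
  have h2 := treeProblem_isL.le_nonDom hn hN.symm
  exact le_antisymm h1 (by rw [← hN]; exact_mod_cast h2)

/-- The constants are arbitrary, and the given instance shows them to be large enough: `1 ≤ W ≤ CW`,
`L ≤ N ≤ CN * L` gives `1 ≤ CN`, `1 ≤ L ≤ CL * F n`, and an in-degree of at least one gives `0 <
Cdeg`. -/
theorem treeProblem_admissible {F : ℕ → ℝ} {CW Cdeg CK CN CL : ℝ}
    (hI : I.Admissible F CW Cdeg CK CN CL) (hdeg : 0 < Cdeg → 2 ≤ Cdeg * Real.log n) (hn2 : 2 ≤ n)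
    (hKle : (K : ℝ) ≤ CK * √n) : (treeProblem n K hn hK).Admissible F CW Cdeg CK CN CL := by
  obtain ⟨L, N, hL, hN, h1, h2, h3⟩ := hI.pareto
  have hL1 : (1 : ℝ) ≤ L := by exact_mod_cast hL.pos hn
  have hLN : (L : ℝ) ≤ N := by exact_mod_cast hL.le_nonDom hn hN
  have hdeg' : 2 ≤ Cdeg * Real.log n := by
    apply hdeg
    have : ∃ v, v ≠ I.s := by
      have : Nontrivial (Fin n) := Fin.nontrivial_iff_two_le.2 hn2
      exact exists_ne I.s
    obtain ⟨v, hv⟩ := this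
    have h4 : (1 : ℝ) ≤ I.G.inDeg v := by exact_mod_cast I.one_le_inDeg hv
    have h5 := h4.trans (hI.in_degree v)
    by_contra hc
    have := mul_nonpos_of_nonpos_of_nonneg (not_lt.1 hc) (Real.log_natCast_nonneg n)
    linarith
  refine ⟨?_, fun v => ?_, fun v => ?_, hKle, 1, 1, treeProblem_isL, treeProblem_nonDom, ?_, ?_, ?_⟩
  · have : (1 : ℝ) ≤ I.W := by exact_mod_cast I.W_pos
    simpa [treeProblem] using this.trans hI.objectives
  · have : ((treeGraph n).outDeg v : ℝ) ≤ 2 := by exact_mod_cast treeGraph_outDeg_le v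
    exact this.trans hdeg'
  · have h4 : (treeGraph n).inDeg v ≤ 1 :=
      (treeGraph_inDeg_le v).trans (by split_ifs <;> omega)
    have : ((treeGraph n).inDeg v : ℝ) ≤ 1 := by exact_mod_cast h4
    exact this.trans (by linarith)
  · have : 1 ≤ CN := by
      by_contra hc
      have := mul_lt_mul_of_pos_right (not_le.1 hc) (by linarith : (0 : ℝ) < L)
      linarith
    simpa using this
  · have : (1 : ℝ) ≤ K := by exact_mod_cast hK
    simpa [treeProblem] using this
  · push_cast
    linarith

end Admissible

/-! ## The comparison -/

section Comparison

variable {n : ℕ}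

theorem natLog_two_le (n : ℕ) : (Nat.log 2 n : ℝ) ≤ 2 * Real.log n := by
  have h1 : (Nat.log 2 n : ℝ) ≤ Real.logb 2 n := by exact_mod_cast Real.natLog_le_logb n 2
  refine h1.trans ?_
  rw [Real.logb, div_le_iff₀ (Real.log_pos one_lt_two)]
  have := Real.log_two_gt_d9
  nlinarith [Real.log_natCast_nonneg n]

theorem Problem.Admissible.idaqTime_le {F : ℕ → ℝ} {CW Cdeg CK CN CL a : ℝ} {I : Problem n}
    (hI : I.Admissible F CW Cdeg CK CN CL) (ha : 1 ≤ a) (hCW : CW ≤ a) (hCdeg : Cdeg ≤ a)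
    (hCK : CK ≤ a) (hCNL : CN * CL ≤ a) (hCL : CL ≤ a) (hn : 0 < n) (hx : 1 ≤ Real.log n)
    (hxr : Real.log n ^ 3 ≤ √n) (hF : 0 < F n) (hFx : F n ≤ Real.log n) :
    ((idaqTime I : ℕ∞) : ℝ≥0∞) ≤ ENNReal.ofReal (100 * a ^ 6 * (√n ^ 3 * F n)) := by
  obtain ⟨L, N, hL, hN, h1, h2, h3⟩ := hI.pareto
  have hL1 : (1 : ℝ) ≤ L := by exact_mod_cast hL.pos hn
  have hLN : (L : ℝ) ≤ N := by exact_mod_cast hL.le_nonDom hn hN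
  have hWpos : (0 : ℝ) < I.W := by exact_mod_cast I.W_pos
  have hNK : N * I.W ≤ I.K := by
    rw [le_div_iff₀ hWpos] at h2
    exact_mod_cast h2
  -- A negative `CN` would contradict `1 ≤ L ≤ N ≤ CN * L`.
  have hCN : 0 ≤ CN := by
    by_contra hc
    nlinarith
  have hax : 0 ≤ a * Real.log n := by positivity
  have hdeg : ∀ k : ℕ, (k : ℝ) ≤ Cdeg * Real.log n → k ≤ ⌊a * Real.log n⌋₊ := fun k hk =>
    Nat.le_floor (hk.trans (by gcongr))
  have key := idaqTime_le_idaqBound hN hNK (fun v => hdeg _ (hI.out_degree v))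
    (fun v => hdeg _ (hI.in_degree v))
  have hbound := idaqBound_le (n := n) (W := I.W) (K := I.K) (N := N) (H := I.numExc L)
    (l := Nat.log 2 n) (r := √n) ha hx hxr (Real.sq_sqrt (Nat.cast_nonneg n)).symm
    (f := F n) (hL1.trans (h3.trans (by gcongr))) hFx (hI.objectives.trans hCW)
    (Nat.floor_le hax) (hI.vectors.trans (by gcongr))
    (h1.trans ((mul_le_mul_of_nonneg_left h3 hCN).trans (by rw [← mul_assoc]; gcongr)))
    (numExc_le hn hL.1) (natLog_two_le n)
  refine (ENat.toENNReal_le.2 key).trans ?_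
  rw [ENat.toENNReal_coe, ← ENNReal.ofReal_natCast]
  exact ENNReal.ofReal_le_ofReal hbound

/-- From `n ≤ 8 * (n / 4) ≤ 2 ^ (Nat.log 2 (n / 4) + 4)` and `log 2 ≤ 1`, the binary logarithm is at
least `log n - 4`, hence at least half of `log n` when `log n ≥ 8`. -/
theorem mul_log_div_le_natLog (hn : 64 ≤ n) (hx : 8 ≤ Real.log n) :
    (n : ℝ) * Real.log n / 16 ≤ ((n / 4) * Nat.log 2 (n / 4) : ℕ) := by
  have h1 : n ≤ 8 * (n / 4) := by omega
  have h1' : (n : ℝ) / 8 ≤ (n / 4 : ℕ) := by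
    rw [div_le_iff₀ (by norm_num)]
    have : (n : ℝ) ≤ 8 * (n / 4 : ℕ) := by exact_mod_cast h1
    linarith
  have hn0 : (0 : ℝ) < n := by exact_mod_cast (by omega : 0 < n)
  have h2 : Real.log n / 2 ≤ Nat.log 2 (n / 4) := by
    have h3 : (n / 4 : ℕ) < 2 ^ (Nat.log 2 (n / 4) + 1) := Nat.lt_pow_succ_log_self one_lt_two _
    have h4 : ((n / 4 : ℕ) : ℝ) < 2 ^ (Nat.log 2 (n / 4) + 1) := by exact_mod_cast h3
    have h5 : (n : ℝ) ≤ 2 ^ (Nat.log 2 (n / 4) + 4) := by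
      rw [div_le_iff₀ (by norm_num)] at h1'
      calc (n : ℝ) ≤ 2 ^ (Nat.log 2 (n / 4) + 1) * 8 := by linarith
        _ = _ := by ring
    have h6 := Real.log_le_log hn0 h5
    rw [Real.log_pow] at h6
    push_cast at h6
    have h7 : Real.log 2 ≤ 1 := by linarith [Real.log_two_lt_d9]
    have h8 : (0 : ℝ) ≤ (Nat.log 2 (n / 4) : ℝ) + 4 := by positivity
    have h9 := mul_le_mul_of_nonneg_left h7 h8
    linarith
  push_cast
  calc (n : ℝ) * Real.log n / 16 = (n / 8) * (Real.log n / 2) := by ring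
    _ ≤ _ := by
      have := Real.log_natCast_nonneg n
      exact mul_le_mul h1' h2 (by positivity) (by positivity)

/-- The bound for IDAQ uses the number of vectors of `I` only through `CK * √n`, so the number `K`
of vectors of the competing tree can be chosen freely. This one comparison serves both kinds of
worst case. -/
theorem eventually_comparison {F : ℕ → ℝ} (hF : F =o[atTop] fun n : ℕ => Real.log n)
    (hpos : ∀ᶠ n in atTop, 0 < F n) (CW Cdeg CK CN CL : ℝ) {c₀ : ℝ} (hc₀ : 0 < c₀) :
    ∃ c : ℝ, 0 < c ∧ ∀ᶠ n : ℕ in atTop, ∀ I : Problem n, I.Admissible F CW Cdeg CK CN CL →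
      ∀ K : ℕ, 0 < K → c₀ * √(n : ℝ) ≤ K → (K : ℝ) ≤ CK * √n →
      ∃ J : Problem n, J.Admissible F CW Cdeg CK CN CL ∧ J.G.numEdges ≤ I.G.numEdges ∧ J.K = K ∧
        ENNReal.ofReal (c * (Real.log n / F n)) * ((idaqTime I : ℕ∞) : ℝ≥0∞) ≤
          (((standardTime J : ℕ) : ℕ∞) : ℝ≥0∞) := by
  set a := max 1 (max CW (max Cdeg (max CK (max (CN * CL) CL)))) with ha
  have ha1 : 1 ≤ a := le_max_left _ _
  have ha0 : 0 < a := by linarith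
  have hlog : Tendsto (fun n : ℕ => Real.log n) atTop atTop :=
    Real.tendsto_log_atTop.comp tendsto_natCast_atTop_atTop
  -- The factor `1600` is `100` from `idaqBound_le` times `16` from `mul_log_div_le_natLog`.
  refine ⟨c₀ / (1600 * a ^ 6), by positivity, ?_⟩
  have hcube : ∀ᶠ n : ℕ in atTop, Real.log n ^ 3 ≤ √n := by
    have h1 := (Real.isLittleO_pow_log_id_atTop (n := 6)).bound (one_pos)
    have h2 := tendsto_natCast_atTop_atTop (R := ℝ).eventually h1
    filter_upwards [h2] with n hn
    have h0 := Real.log_natCast_nonneg n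
    rw [Real.norm_of_nonneg (by positivity), id, Real.norm_of_nonneg (Nat.cast_nonneg n)] at hn
    refine Real.le_sqrt_of_sq_le ?_
    calc (Real.log n ^ 3) ^ 2 = Real.log n ^ 6 := by ring
      _ ≤ _ := by linarith
  have hdeg : ∀ᶠ n : ℕ in atTop, 0 < Cdeg → 2 ≤ Cdeg * Real.log n := by
    by_cases h : 0 < Cdeg
    · filter_upwards [(hlog.const_mul_atTop h).eventually_ge_atTop 2] with n hn _ using hn
    · exact Eventually.of_forall fun n h' => absurd h' h
  filter_upwards [hcube, hdeg, hpos, hF.bound one_pos, hlog.eventually_ge_atTop 8,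
    eventually_ge_atTop 64] with n hn3 hnd hFn hFx hx hn64 I hI K hK hc₀K hKle
  have hn0 : 0 < n := by omega
  have hFx' : F n ≤ Real.log n := by
    have := (le_abs_self _).trans hFx
    rwa [one_mul, Real.norm_of_nonneg (by linarith)] at this
  refine ⟨treeProblem n K hn0 hK, treeProblem_admissible hI hnd (by omega) hKle,
    treeGraph_numEdges_le I hn0, rfl, ?_⟩
  have h1 := hI.idaqTime_le ha1
    (le_max_of_le_right (le_max_left _ _))
    (le_max_of_le_right (le_max_of_le_right (le_max_left _ _)))
    (le_max_of_le_right (le_max_of_le_right (le_max_of_le_right (le_max_left _ _))))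
    (le_max_of_le_right (le_max_of_le_right (le_max_of_le_right
      (le_max_of_le_right (le_max_left _ _)))))
    (le_max_of_le_right (le_max_of_le_right (le_max_of_le_right
      (le_max_of_le_right (le_max_right _ _))))) hn0 (by linarith) hn3 hFn hFx'
  have h2 : (K : ℝ) * (n * Real.log n / 16) ≤ standardTime (treeProblem n K hn0 hK) := by
    refine le_trans (mul_le_mul_of_nonneg_left (mul_log_div_le_natLog hn64 hx) (Nat.cast_nonneg K)) ?_
    exact_mod_cast treeProblem_standardTime hn0 hK
  refine (mul_le_mul_right h1 _).trans ?_
  rw [← ENNReal.ofReal_mul (by positivity), ENat.toENNReal_coe, ← ENNReal.ofReal_natCast]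
  refine ENNReal.ofReal_le_ofReal (le_trans ?_ h2)
  have h3 : √(n : ℝ) ^ 3 = √n * n := by
    rw [pow_succ, Real.sq_sqrt (Nat.cast_nonneg n)]; ring
  rw [h3]
  calc c₀ / (1600 * a ^ 6) * (Real.log n / F n) * (100 * a ^ 6 * (√n * n * F n))
      = c₀ * √n * (n * Real.log n / 16) := by field_simp; ring
    _ ≤ _ := by gcongr

theorem mul_worstCase_le {S : Set (Problem n)} {T : Problem n → ℕ∞} {x y : ℝ≥0∞}
    (h : ∀ I ∈ S, x * ((T I : ℕ∞) : ℝ≥0∞) ≤ y) : x * worstCase S T ≤ y := by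
  unfold worstCase
  simp_rw [ENNReal.mul_iSup]
  exact iSup₂_le h

theorem le_worstCase {S : Set (Problem n)} {I : Problem n} (hI : I ∈ S) (T : Problem n → ℕ∞) :
    ((T I : ℕ∞) : ℝ≥0∞) ≤ worstCase S T :=
  le_iSup₂ (f := fun I (_ : I ∈ S) => ((T I : ℕ∞) : ℝ≥0∞)) I hI

theorem exists_speedup {F : ℕ → ℝ} (hF : F =o[atTop] fun n : ℕ => Real.log n)
    (hpos : ∀ᶠ n in atTop, 0 < F n) (CW Cdeg CK CN CL : ℝ) :
    ∃ c : ℝ, 0 < c ∧ ∀ᶠ n : ℕ in atTop, ∀ m : ℕ,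
      ENNReal.ofReal (c * (Real.log n / F n)) *
          worstCase (Problem.admissible F CW Cdeg CK CN CL n m) (fun I => idaqTime I) ≤
        worstCase (Problem.admissible F CW Cdeg CK CN CL n m)
          (fun I => (standardTime I : ℕ∞)) := by
  by_cases hCK : 0 < CK
  · obtain ⟨c, hc, h⟩ := eventually_comparison hF hpos CW Cdeg CK CN CL (half_pos hCK)
    refine ⟨c, hc, ?_⟩
    filter_upwards [h] with n hn m
    refine mul_worstCase_le fun I hI => ?_
    have h1 : (1 : ℝ) ≤ CK * √n := le_trans (by exact_mod_cast I.K_pos) hI.1.vectors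
    have h2 : 0 < ⌊CK * √(n : ℝ)⌋₊ := Nat.floor_pos.2 h1
    -- The floor of a real number that is at least one is at least half of that number.
    have h3 : CK / 2 * √(n : ℝ) ≤ ⌊CK * √(n : ℝ)⌋₊ := by
      have h4 := Nat.lt_floor_add_one (CK * √(n : ℝ))
      have h5 : (1 : ℝ) ≤ ⌊CK * √(n : ℝ)⌋₊ := by exact_mod_cast h2
      linarith
    obtain ⟨J, hJ, hJm, -, hle⟩ := hn I hI.1 _ h2 h3 (Nat.floor_le (by linarith))
    exact hle.trans (le_worstCase (S := Problem.admissible F CW Cdeg CK CN CL n m)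
      ⟨hJ, hJm.trans hI.2⟩ fun I => (standardTime I : ℕ∞))
  -- If `CK ≤ 0`, no instance is admissible, because `K ≥ 1`.
  · refine ⟨1, one_pos, Eventually.of_forall fun n m => ?_⟩
    refine mul_worstCase_le fun I hI => ?_
    have h1 : (1 : ℝ) ≤ CK * √n := le_trans (by exact_mod_cast I.K_pos) hI.1.vectors
    have := mul_nonpos_of_nonpos_of_nonneg (not_lt.1 hCK) (Real.sqrt_nonneg n)
    linarith

end Comparison

end MOWSP

theorem mainTheorem5 (F : ℕ → ℝ) (hF : F =o[atTop] fun n : ℕ => Real.log n)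
    (hpos : ∀ᶠ n in atTop, 0 < F n) (CW Cdeg CK CN CL : ℝ) :
    (∃ c : ℝ, 0 < c ∧ ∀ᶠ n : ℕ in atTop, ∀ m : ℕ,
      ENNReal.ofReal (c * (Real.log n / F n)) *
          MOWSP.worstCase (MOWSP.Problem.admissible F CW Cdeg CK CN CL n m)
            (fun I => MOWSP.idaqTime I) ≤
        MOWSP.worstCase (MOWSP.Problem.admissible F CW Cdeg CK CN CL n m)
          (fun I => (MOWSP.standardTime I : ℕ∞))) ∧
    (∀ c₀ : ℝ, 0 < c₀ → ∃ c : ℝ, 0 < c ∧ ∀ᶠ n : ℕ in atTop, ∀ m k : ℕ, c₀ * √(n : ℝ) ≤ k →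
      ENNReal.ofReal (c * (Real.log n / F n)) *
          MOWSP.worstCase (MOWSP.Problem.admissibleWith F CW Cdeg CK CN CL n m k)
            (fun I => MOWSP.idaqTime I) ≤
        MOWSP.worstCase (MOWSP.Problem.admissibleWith F CW Cdeg CK CN CL n m k)
          (fun I => (MOWSP.standardTime I : ℕ∞))) ∧
    (F =O[atTop] (fun _ : ℕ => (1 : ℝ)) →
      ∃ c : ℝ, 0 < c ∧ ∀ᶠ n : ℕ in atTop, ∀ m : ℕ,
        ENNReal.ofReal (c * Real.log n) *
            MOWSP.worstCase (MOWSP.Problem.admissible F CW Cdeg CK CN CL n m)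
              (fun I => MOWSP.idaqTime I) ≤
          MOWSP.worstCase (MOWSP.Problem.admissible F CW Cdeg CK CN CL n m)
            (fun I => (MOWSP.standardTime I : ℕ∞))) := by
  have h1 := MOWSP.exists_speedup hF hpos CW Cdeg CK CN CL
  refine ⟨h1, fun c₀ hc₀ => ?_, fun hO => ?_⟩
  · obtain ⟨c, hc, h⟩ := MOWSP.eventually_comparison hF hpos CW Cdeg CK CN CL hc₀
    refine ⟨c, hc, ?_⟩
    filter_upwards [h] with n hn m k hk
    refine MOWSP.mul_worstCase_le fun I hI => ?_
    obtain ⟨hI1, hI2, rfl⟩ := hI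
    obtain ⟨J, hJ, hJm, hJK, hle⟩ := hn I hI1 _ I.K_pos hk hI1.vectors
    exact hle.trans (MOWSP.le_worstCase
      (S := MOWSP.Problem.admissibleWith F CW Cdeg CK CN CL n m I.K)
      ⟨hJ, hJm.trans hI2, hJK⟩ fun I => (MOWSP.standardTime I : ℕ∞))
  · obtain ⟨c, hc, h⟩ := h1
    obtain ⟨M, hM, hb⟩ := hO.exists_pos
    -- Since `F n ≤ M` eventually, `c / M * log n ≤ c * (log n / F n)`.
    refine ⟨c / M, by positivity, ?_⟩
    filter_upwards [h, hb.bound, hpos] with n hn hFM hFn m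
    refine le_trans (mul_le_mul_left (ENNReal.ofReal_le_ofReal ?_) _) (hn m)
    have h2 : F n ≤ M := by simpa [abs_of_pos hFn] using hFM
    rw [div_mul_eq_mul_div, mul_div_assoc]
    have := Real.log_natCast_nonneg n
    gcongr
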